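/- **Theorem (Normalization for $\lambda_{\mathrm G}$).** Let $t:A$ be a proof term of the parallel $\lambda$-calculus $\lambda_{\mathrm G}$, with arbitrary free variables. Then there is a proof term $t'$ with $t\mapsto^{*}t'$ (finitely many reduction steps) such that $t':A$, every free variable of $t'$ is a free variable of $t$, $t'$ is a parallel form, and $t'$ is normal (there is no $t''$ with $t'\mapsto t''$). Consequently $t'$ is a parallel composition of normal simply typed $\lambda$-terms, and, reading typed terms as deductions of the natural deduction calculus $\mathbf{NG}$ for Gödel logic, every $\mathbf{NG}$-deduction of $A$ reduces to a normal one of $A$ from at most the same open hypotheses. *Calculus.* Formulas are built from propositional variables and $\bot$ by $\wedge,\to$; $\top:=\bot\to\bot$. Terms, up to $\alpha$-equivalence, are typed as follows: variables $x^A:A$; $\lambda x^A u:A\to B$ if $u:B$; $tu:B$ if $t:A\to B$, $u:A$; $\langle u,t\rangle:A\wedge B$ if $u:A$, $t:B$; $u\,\pi_0:A$ and $u\,\pi_1:B$ if $u:A\wedge B$; $\mathsf{efq}_P(u):P$ if $u:\bot$, where $P$ is a propositional variable; and $u\parallel_a v:C$ if $u:C$ and $v:C$, where $a$, of type $A\to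 B$ in $u$ and of type $B\to A$ in $v$, becomes bound. The pair $A,B$, recorded in the operator, is the communication kind of $a$. A simply typed $\lambda$-term is a term without $\parallel$; parallel forms are the simply typed $\lambda$-terms and, recursively, the terms $u\parallel_a v$ with $u,v$ parallel forms. Write $\langle t_1,\dots,t_n\rangle=\langle t_1,\langle t_2,\dots\rangle\rangle$ and $A_1\wedge\dots\wedge A_n=A_1\wedge(A_2\wedge\dots)$; for $n=0$ these are $\lambda x^\bot x$ and $\top$. *Complexity.* A formula is prime if it is not a conjunction; every formula is a conjunction of prime formulas, its prime factors. A strong subformula of $A$ is a proper subformula of a prime proper subformula of $A$. If $u\parallel_a v:A$ has free variables of types $A_1,\dots,A_n$ and $a$ has kind $B,C$, the communication complexity of $a$ in it is the maximum of $0$ and the numbers of symbols of those prime factors of $B$ or $C$ that are neither proper subformulas of $A$ nor strong subformulas of some $A_i$. *Reductions.* $\mapsto$ is the closure under all contexts of the following rules, and $\mapsto^*$ is its reflexive transitive closure. 1. $(\lambda x\,u)t\mapsto u[t/x]$ and $\langle u_0,u_1\rangle\pi_i\mapsto u_i$. 2. With $a$ not free in $w$: $(u\parallel_a v)w\mapsto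 uw\parallel_a vw$; $w(u\parallel_a v)\mapsto wu\parallel_a wv$; $\langle u\parallel_a v,w\rangle\mapsto\langle u,w\rangle\parallel_a\langle v,w\rangle$; $\langle w,u\parallel_a v\rangle\mapsto\langle w,u\rangle\parallel_a\langle w,v\rangle$. Also $\mathsf{efq}_P(u\parallel_a v)\mapsto\mathsf{efq}_P(u)\parallel_a\mathsf{efq}_P(v)$; $(u\parallel_a v)\pi_i\mapsto u\pi_i\parallel_a v\pi_i$; $\lambda x(u\parallel_a v)\mapsto\lambda x\,u\parallel_a\lambda x\,v$. If the communication complexity of $b$ in the term on the left is positive (and $a$ is not free in $w$): $(u\parallel_a v)\parallel_b w\mapsto(u\parallel_b w)\parallel_a(v\parallel_b w)$ and $w\parallel_b(u\parallel_a v)\mapsto(w\parallel_b u)\parallel_a(w\parallel_b v)$. 3. $u\parallel_a v\mapsto u$ if $a$ does not occur in $u$; $u\parallel_a v\mapsto v$ if $a$ does not occur in $v$. 4. $\mathcal C[a\,u]\parallel_a\mathcal D[a\,v]\mapsto(\mathcal D[u^{b\langle\mathbf z\rangle/\mathbf y}]\parallel_a\mathcal C[a\,u])\parallel_b(\mathcal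 C[v^{b\langle\mathbf y\rangle/\mathbf z}]\parallel_a\mathcal D[a\,v])$, if the communication complexity of $a$ in the term on the left is positive, $\mathcal C[a\,u]$ and $\mathcal D[a\,v]$ are normal simply typed $\lambda$-terms, and the displayed occurrences of $a$ are the rightmost ones in them. Here $\mathcal C,\mathcal D$ are contexts with one hole, filled without renaming of bound variables; $\mathbf y$ (resp. $\mathbf z$) is the sequence of the free variables of $u$ bound in $\mathcal C[a\,u]$ (resp. of $v$ bound in $\mathcal D[a\,v]$), each listed once, from the innermost to the outermost binder; $b$ is fresh, its kind being the conjunction of the types of $\mathbf z$ and that of the types of $\mathbf y$; and $s^{w/\mathbf x}$ is the result of replacing each $x_i$ in $s$ by the projection of $w$ to the component of $x_i$. -/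

import Mathlib

namespace LambdaG

/-! ### Formulas -/

/-- Formulas of propositional Gödel logic over the primitive connectives `⊥`, `∧`, `→`
(disjunction is a defined connective, `¬ A` is `A → ⊥`). -/
inductive Form : Type where
  | bot : Form
  | atom : ℕ → Form
  | and : Form → Form → Form
  | imp : Form → Form → Form
  deriving DecidableEq

namespace Form

/-- `⊤` is shorthand for `⊥ → ⊥`. -/
def top : Form := imp bot bot

/-- The number of symbols (atoms, `⊥` and connectives) of a formula. -/
def symbols : Form → ℕ
  | bot => 1
  | atom _ => 1
  | and A B => A.symbols + B.symbols + 1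
  | imp A B => A.symbols + B.symbols + 1

/-- The subformulas of a formula, the formula itself included. -/
def subformulas : Form → Finset Form
  | bot => {bot}
  | atom n => {atom n}
  | and A B => insert (and A B) (A.subformulas ∪ B.subformulas)
  | imp A B => insert (imp A B) (A.subformulas ∪ B.subformulas)

/-- `B` is a proper subformula of `A`. -/
def ProperSubformula (B A : Form) : Prop := B ∈ A.subformulas ∧ B ≠ A

/-- A formula is prime if it is not a conjunction. -/
def IsPrime (A : Form) : Prop := ∀ B C : Form, A ≠ and B C

/-- The prime factors of a formula: the prime formulas of which it is a conjunction. -/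
def primeFactors : Form → Finset Form
  | bot => {bot}
  | atom n => {atom n}
  | and A B => A.primeFactors ∪ B.primeFactors
  | imp A B => {imp A B}

/-- `B` is a strong subformula of `A`: a proper subformula of some prime proper subformula
of `A`. -/
def StrongSubformula (B A : Form) : Prop :=
  ∃ P : Form, P.IsPrime ∧ ProperSubformula P A ∧ ProperSubformula B P

/-- `A₁ ∧ (A₂ ∧ … (Aₙ₋₁ ∧ Aₙ)…)`, and `⊤` for the empty sequence. -/
def conj : List Form → Form
  | [] => top
  | [A] => A
  | A :: B :: l => and A (conj (B :: l))

end Form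

/-! ### Proof terms

Terms are taken up to α-equivalence: variables are de Bruijn indices. -/

/-- Proof terms. `par A B u v` is the parallel composition `u ∥ₐ v` in which the communication
variable `a` has communication kind `A, B`: it is the variable `0` of `u`, where it has type
`A → B`, and the variable `0` of `v`, where it has type `B → A`.  `proj false`, `proj true` are
the projections `π₀`, `π₁`; `efq P u` is ex falso quodlibet with conclusion the atom `P`
(different from `⊥`). -/
inductive Tm : Type where
  | var : ℕ → Tm
  | lam : Form → Tm → Tm
  | app : Tm → Tm → Tm
  | pair : Tm → Tm → Tm
  | proj : Bool → Tm → Tm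
  | efq : ℕ → Tm → Tm
  | par : Form → Form → Tm → Tm → Tm

/-- The type assignment `Γ ⊢ t : A`; its derivations are the natural deductions of `NG`. The type
of the variable `n` is the `n`-th entry of `Γ`. -/
inductive HasType : List Form → Tm → Form → Prop where
  | var {Γ : List Form} {n : ℕ} {A : Form} :
      Γ[n]? = some A → HasType Γ (.var n) A
  | lam {Γ : List Form} {A B : Form} {u : Tm} :
      HasType (A :: Γ) u B → HasType Γ (.lam A u) (.imp A B)
  | app {Γ : List Form} {A B : Form} {t u : Tm} :
      HasType Γ t (.imp A B) → HasType Γ u A → HasType Γ (.app t u) B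
  | pair {Γ : List Form} {A B : Form} {u t : Tm} :
      HasType Γ u A → HasType Γ t B → HasType Γ (.pair u t) (.and A B)
  | proj₀ {Γ : List Form} {A B : Form} {u : Tm} :
      HasType Γ u (.and A B) → HasType Γ (.proj false u) A
  | proj₁ {Γ : List Form} {A B : Form} {u : Tm} :
      HasType Γ u (.and A B) → HasType Γ (.proj true u) B
  | efq {Γ : List Form} {P : ℕ} {u : Tm} :
      HasType Γ u .bot → HasType Γ (.efq P u) (.atom P)
  | par {Γ : List Form} {A B C : Form} {u v : Tm} :
      HasType (.imp A B :: Γ) u C → HasType (.imp B A :: Γ) v C → HasType Γ (.par A B u v) C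

/-- A renaming under one binder. -/
def liftRen (ρ : ℕ → ℕ) : ℕ → ℕ
  | 0 => 0
  | n + 1 => ρ n + 1

/-- The renaming that exchanges the two innermost variables. -/
def swapRen : ℕ → ℕ
  | 0 => 1
  | 1 => 0
  | n + 2 => n + 2

namespace Tm

/-- `occurs n t`: the variable `n` occurs free in `t`. -/
def occurs : ℕ → Tm → Bool
  | n, var m => n == m
  | n, lam _ u => occurs (n + 1) u
  | n, app t u => occurs n t || occurs n u
  | n, pair u t => occurs n u || occurs n t
  | n, proj _ u => occurs n u
  | n, efq _ u => occurs n u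
  | n, par _ _ u v => occurs (n + 1) u || occurs (n + 1) v

/-- Capture-avoiding renaming of the free variables. -/
def rename : (ℕ → ℕ) → Tm → Tm
  | ρ, var n => var (ρ n)
  | ρ, lam A u => lam A (rename (liftRen ρ) u)
  | ρ, app t u => app (rename ρ t) (rename ρ u)
  | ρ, pair u t => pair (rename ρ u) (rename ρ t)
  | ρ, proj i u => proj i (rename ρ u)
  | ρ, efq P u => efq P (rename ρ u)
  | ρ, par A B u v => par A B (rename (liftRen ρ) u) (rename (liftRen ρ) v)

/-- The term `t` seen in the scope of one further (innermost) variable, which does not occur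
in it. -/
def shift (t : Tm) : Tm := t.rename Nat.succ

/-- A substitution under one binder. -/
def liftSub (σ : ℕ → Tm) : ℕ → Tm
  | 0 => var 0
  | n + 1 => (σ n).shift

/-- Simultaneous capture-avoiding substitution for the free variables. -/
def subst : (ℕ → Tm) → Tm → Tm
  | σ, var n => σ n
  | σ, lam A u => lam A (subst (liftSub σ) u)
  | σ, app t u => app (subst σ t) (subst σ u)
  | σ, pair u t => pair (subst σ u) (subst σ t)
  | σ, proj i u => proj i (subst σ u)
  | σ, efq P u => efq P (subst σ u)
  | σ, par A B u v => par A B (subst (liftSub σ) u) (subst (liftSub σ) v)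

/-- `u[t/x]` where `x` is the innermost variable of `u`. -/
def inst (u t : Tm) : Tm :=
  u.subst fun n => match n with
    | 0 => t
    | m + 1 => var m

/-- `⟨t₁, ⟨t₂, … ⟨tₙ₋₁, tₙ⟩…⟩⟩`; the empty tuple is the term `λ x^⊥ x` of type `⊤`. -/
def tuple : List Tm → Tm
  | [] => lam .bot (var 0)
  | [t] => t
  | t :: s :: l => pair t (tuple (s :: l))

/-- `nthProj n i t` is the projection `t π₁ … π₁ π₀` (or `t π₁ … π₁` for the last component)
selecting the `i`-th component, counted from `0`, of a tuple `t` of `n` components. -/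
def nthProj : ℕ → ℕ → Tm → Tm
  | _ + 2, 0, t => proj false t
  | n + 2, i + 1, t => nthProj (n + 1) i (proj true t)
  | _, _, t => t

/-- A simply typed λ-term: the parallel operator does not occur in it. -/
def ParFree : Tm → Prop
  | var _ => True
  | lam _ u => ParFree u
  | app t u => ParFree t ∧ ParFree u
  | pair u t => ParFree u ∧ ParFree t
  | proj _ u => ParFree u
  | efq _ u => ParFree u
  | par _ _ _ _ => False

/-- Parallel forms: parallel compositions, bracketed in any way, of simply typed λ-terms. -/
inductive ParallelForm : Tm → Prop where
  | simple {t : Tm} : ParFree t → ParallelForm t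
  | par {A B : Form} {u v : Tm} :
      ParallelForm u → ParallelForm v → ParallelForm (par A B u v)

end Tm

/-! ### Simple contexts -/

/-- Contexts with exactly one hole and with no parallel operator above the hole. (They are only
used where the filled context is a simply typed λ-term, so that they are simple contexts.) -/
inductive Ctx : Type where
  | hole : Ctx
  | lam : Form → Ctx → Ctx
  | appL : Ctx → Tm → Ctx
  | appR : Tm → Ctx → Ctx
  | pairL : Ctx → Tm → Ctx
  | pairR : Tm → Ctx → Ctx
  | proj : Bool → Ctx → Ctx
  | efq : ℕ → Ctx → Ctx

namespace Ctx

/-- `𝒞[u]`, without renaming of bound variables: the free variables of `u` may be captured. -/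
def fill : Ctx → Tm → Tm
  | hole, u => u
  | lam A 𝒞, u => .lam A (𝒞.fill u)
  | appL 𝒞 t, u => .app (𝒞.fill u) t
  | appR t 𝒞, u => .app t (𝒞.fill u)
  | pairL 𝒞 t, u => .pair (𝒞.fill u) t
  | pairR t 𝒞, u => .pair t (𝒞.fill u)
  | proj i 𝒞, u => .proj i (𝒞.fill u)
  | efq P 𝒞, u => .efq P (𝒞.fill u)

/-- The types of the λ-variables bound at the hole, innermost first: at the hole, the variable
`i < 𝒞.binders.length` is the λ-variable whose type is the `i`-th entry. -/
def binders : Ctx → List Form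
  | hole => []
  | lam A 𝒞 => 𝒞.binders ++ [A]
  | appL 𝒞 _ => 𝒞.binders
  | appR _ 𝒞 => 𝒞.binders
  | pairL 𝒞 _ => 𝒞.binders
  | pairR _ 𝒞 => 𝒞.binders
  | proj _ 𝒞 => 𝒞.binders
  | efq _ 𝒞 => 𝒞.binders

/-- The number of λ-variables bound at the hole. -/
def depth (𝒞 : Ctx) : ℕ := 𝒞.binders.length

/-- Renaming of the variables that are free in the context. -/
def rename : (ℕ → ℕ) → Ctx → Ctx
  | _, hole => hole
  | ρ, lam A 𝒞 => lam A (rename (liftRen ρ) 𝒞)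
  | ρ, appL 𝒞 t => appL (rename ρ 𝒞) (t.rename ρ)
  | ρ, appR t 𝒞 => appR (t.rename ρ) (rename ρ 𝒞)
  | ρ, pairL 𝒞 t => pairL (rename ρ 𝒞) (t.rename ρ)
  | ρ, pairR t 𝒞 => pairR (t.rename ρ) (rename ρ 𝒞)
  | ρ, proj i 𝒞 => proj i (rename ρ 𝒞)
  | ρ, efq P 𝒞 => efq P (rename ρ 𝒞)

/-- The free variable `n` of the context occurs to the right of the hole. -/
def occursRight : ℕ → Ctx → Bool
  | _, hole => false
  | n, lam _ 𝒞 => occursRight (n + 1) 𝒞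
  | n, appL 𝒞 t => occursRight n 𝒞 || t.occurs n
  | n, appR _ 𝒞 => occursRight n 𝒞
  | n, pairL 𝒞 t => occursRight n 𝒞 || t.occurs n
  | n, pairR _ 𝒞 => occursRight n 𝒞
  | n, proj _ 𝒞 => occursRight n 𝒞
  | n, efq _ 𝒞 => occursRight n 𝒞

/-- The term `𝒞[a u]`, where `a` is the variable `0` outside of `𝒞`. -/
def fillComm (𝒞 : Ctx) (u : Tm) : Tm := 𝒞.fill (.app (.var 𝒞.depth) u)

/-- The displayed occurrence of `a` in `𝒞[a u]` is the rightmost one. -/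
def Rightmost (𝒞 : Ctx) (u : Tm) : Prop :=
  𝒞.occursRight 0 = false ∧ u.occurs 𝒞.depth = false

/-- The sequence of the free variables of `u` which are bound in `𝒞[a u]`, each one listed once,
with its type, from the innermost to the outermost. -/
def boundVars (𝒞 : Ctx) (u : Tm) : List (Form × ℕ) :=
  𝒞.binders.zipIdx.filter fun p => u.occurs p.2

end Ctx

/-- The conjunction of the types of a sequence of variables. -/
def conjTypes (y : List (Form × ℕ)) : Form := Form.conj (y.map Prod.fst)

/-- The tuple `⟨y⟩` of a sequence of variables. -/
def tupleVars (y : List (Form × ℕ)) : Tm := Tm.tuple (y.map fun p => Tm.var p.2)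

/-- The term `u^{b⟨z⟩/y}`, moved from the hole of a context binding `k` λ-variables (with the
communication variable `a`, index `k`, and then the outer variables outside of it) to the hole of
a context binding `m` λ-variables, with outside of it first `a`, index `m`, then the new
communication variable `b`, index `m + 1`, and then the same outer variables.
Each variable of the sequence `y` is replaced by the corresponding projection of `b⟨z⟩`; the outer
variables are kept, i.e. the index `k + 1 + j` becomes `m + 2 + j`. (In the use below no other
variable occurs in `u`.) -/
def migrate (k m : ℕ) (y z : List (Form × ℕ)) (u : Tm) : Tm :=
  u.subst fun i =>
    if i ∈ y.map Prod.snd then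
      Tm.nthProj y.length ((y.map Prod.snd).idxOf i) (.app (.var (m + 1)) (tupleVars z))
    else .var (i + m + 1 - k)

/-! ### Communication complexity -/

/-- `A` is the type, in `Γ`, of some free variable of `t`. -/
def IsFreeVarType (Γ : List Form) (t : Tm) (A : Form) : Prop :=
  ∃ n : ℕ, t.occurs n = true ∧ Γ[n]? = some A

open Classical in
/-- The communication complexity of `a` in `t = u ∥ₐ v : A`, where `B, C` is the communication
kind of `a`: the maximum among `0` and the numbers of symbols of the prime factors of `B` or `C`
that are neither proper subformulas of `A` nor strong subformulas of the type of some free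
variable of `t`. -/
noncomputable def commComplexity (Γ : List Form) (t : Tm) (A B C : Form) : ℕ :=
  ((B.primeFactors ∪ C.primeFactors).filter fun P =>
      ¬ P.ProperSubformula A ∧ ∀ D : Form, IsFreeVarType Γ t D → ¬ P.StrongSubformula D).sup
    Form.symbols

/-- In the scope `Γ`, the term `u ∥ₐ v`, with `B, C` the communication kind of `a`, is typed and
the communication complexity of `a` in it is greater than `0`. -/
def PosComm (Γ : List Form) (B C : Form) (u v : Tm) : Prop :=
  ∃ A : Form, HasType Γ (.par B C u v) A ∧ 0 < commComplexity Γ (.par B C u v) A B C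

/-! ### Reductions -/

/-- The closure of a relation under all contexts: `ℰ[t] ↦ ℰ[u]` whenever `t ↦ u`. The list records
the types of the variables in scope. -/
inductive Compat (R : List Form → Tm → Tm → Prop) : List Form → Tm → Tm → Prop where
  | base {Γ : List Form} {t t' : Tm} : R Γ t t' → Compat R Γ t t'
  | lam {Γ : List Form} {A : Form} {u u' : Tm} :
      Compat R (A :: Γ) u u' → Compat R Γ (.lam A u) (.lam A u')
  | appL {Γ : List Form} {t t' u : Tm} :
      Compat R Γ t t' → Compat R Γ (.app t u) (.app t' u)
  | appR {Γ : List Form} {t u u' : Tm} :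
      Compat R Γ u u' → Compat R Γ (.app t u) (.app t u')
  | pairL {Γ : List Form} {u u' t : Tm} :
      Compat R Γ u u' → Compat R Γ (.pair u t) (.pair u' t)
  | pairR {Γ : List Form} {u t t' : Tm} :
      Compat R Γ t t' → Compat R Γ (.pair u t) (.pair u t')
  | proj {Γ : List Form} {i : Bool} {u u' : Tm} :
      Compat R Γ u u' → Compat R Γ (.proj i u) (.proj i u')
  | efq {Γ : List Form} {P : ℕ} {u u' : Tm} :
      Compat R Γ u u' → Compat R Γ (.efq P u) (.efq P u')
  | parL {Γ : List Form} {A B : Form} {u u' v : Tm} :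
      Compat R (.imp A B :: Γ) u u' → Compat R Γ (.par A B u v) (.par A B u' v)
  | parR {Γ : List Form} {A B : Form} {u v v' : Tm} :
      Compat R (.imp B A :: Γ) v v' → Compat R Γ (.par A B u v) (.par A B u v')

/-- Intuitionistic reductions. -/
inductive Intuitionistic : Tm → Tm → Prop where
  | beta (A : Form) (u t : Tm) : Intuitionistic (.app (.lam A u) t) (u.inst t)
  | proj₀ (u₀ u₁ : Tm) : Intuitionistic (.proj false (.pair u₀ u₁)) u₀
  | proj₁ (u₀ u₁ : Tm) : Intuitionistic (.proj true (.pair u₀ u₁)) u₁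

/-- Permutation reductions. Terms that enter the scope of a communication variable are shifted,
hence that variable does not occur in them; where two binders are exchanged, so are the variables
that they bind. -/
inductive Permutation : List Form → Tm → Tm → Prop where
  | appL (Γ : List Form) (A B : Form) (u v w : Tm) :
      Permutation Γ (.app (.par A B u v) w) (.par A B (.app u w.shift) (.app v w.shift))
  | appR (Γ : List Form) (A B : Form) (u v w : Tm) :
      Permutation Γ (.app w (.par A B u v)) (.par A B (.app w.shift u) (.app w.shift v))
  | efq (Γ : List Form) (A B : Form) (P : ℕ) (u v : Tm) :
      Permutation Γ (.efq P (.par A B u v)) (.par A B (.efq P u) (.efq P v))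
  | proj (Γ : List Form) (A B : Form) (i : Bool) (u v : Tm) :
      Permutation Γ (.proj i (.par A B u v)) (.par A B (.proj i u) (.proj i v))
  | lam (Γ : List Form) (A B C : Form) (u v : Tm) :
      Permutation Γ (.lam C (.par A B u v))
        (.par A B (.lam C (u.rename swapRen)) (.lam C (v.rename swapRen)))
  | pairL (Γ : List Form) (A B : Form) (u v w : Tm) :
      Permutation Γ (.pair (.par A B u v) w) (.par A B (.pair u w.shift) (.pair v w.shift))
  | pairR (Γ : List Form) (A B : Form) (u v w : Tm) :
      Permutation Γ (.pair w (.par A B u v)) (.par A B (.pair w.shift u) (.pair w.shift v))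
  | parL (Γ : List Form) (A B C D : Form) (u v w : Tm) :
      PosComm Γ C D (.par A B u v) w →
      Permutation Γ (.par C D (.par A B u v) w)
        (.par A B (.par C D (u.rename swapRen) (w.rename (liftRen Nat.succ)))
          (.par C D (v.rename swapRen) (w.rename (liftRen Nat.succ))))
  | parR (Γ : List Form) (A B C D : Form) (u v w : Tm) :
      PosComm Γ C D w (.par A B u v) →
      Permutation Γ (.par C D w (.par A B u v))
        (.par A B (.par C D (w.rename (liftRen Nat.succ)) (u.rename swapRen))
          (.par C D (w.rename (liftRen Nat.succ)) (v.rename swapRen)))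

/-- A term without intuitionistic redexes (the list of types plays no role here). For simply typed
λ-terms this is normality, see `intNormal_iff_isNormal` below. -/
def IntNormal (t : Tm) : Prop :=
  ∀ t' : Tm, ¬ Compat (fun _ => Intuitionistic) [] t t'

/-- Cross reductions. The terms `u.shift`, `v.shift` are those in which the communication variable
does not occur. In `cross`, `b` is the variable bound by the outermost parallel operator of the
result, which has kind `conjTypes z`, `conjTypes y`; inside of it, in the scope of `a`, the
renaming `liftRen Nat.succ` keeps `a` and makes room for `b`. -/
inductive Cross : List Form → Tm → Tm → Prop where
  | left (Γ : List Form) (A B : Form) (u v : Tm) : Cross Γ (.par A B u.shift v) u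
  | right (Γ : List Form) (A B : Form) (u v : Tm) : Cross Γ (.par A B u v.shift) v
  | cross (Γ : List Form) (A B : Form) (𝒞 𝒟 : Ctx) (u v : Tm) (y z : List (Form × ℕ)) :
      (𝒞.fillComm u).ParFree → IntNormal (𝒞.fillComm u) →
      (𝒟.fillComm v).ParFree → IntNormal (𝒟.fillComm v) →
      𝒞.Rightmost u → 𝒟.Rightmost v →
      y = 𝒞.boundVars u → z = 𝒟.boundVars v →
      PosComm Γ A B (𝒞.fillComm u) (𝒟.fillComm v) →
      Cross Γ (.par A B (𝒞.fillComm u) (𝒟.fillComm v))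
        (.par (conjTypes z) (conjTypes y)
          (.par B A
            ((𝒟.rename (liftRen Nat.succ)).fill (migrate 𝒞.depth 𝒟.depth y z u))
            ((𝒞.fillComm u).rename (liftRen Nat.succ)))
          (.par A B
            ((𝒞.rename (liftRen Nat.succ)).fill (migrate 𝒟.depth 𝒞.depth z y v))
            ((𝒟.fillComm v).rename (liftRen Nat.succ))))

/-- The basic reductions. -/
inductive Basic : List Form → Tm → Tm → Prop where
  | int {Γ : List Form} {t t' : Tm} : Intuitionistic t t' → Basic Γ t t'
  | perm {Γ : List Form} {t t' : Tm} : Permutation Γ t t' → Basic Γ t t'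
  | cross {Γ : List Form} {t t' : Tm} : Cross Γ t t' → Basic Γ t t'

/-- One-step reduction `t ↦ t'` of terms whose free variables have the types listed in `Γ`. -/
def Step : List Form → Tm → Tm → Prop := Compat Basic

/-- Normal forms. -/
def IsNormal (Γ : List Form) (t : Tm) : Prop := ∀ t' : Tm, ¬ Step Γ t t'

/-- For simply typed λ-terms, having no intuitionistic redex is the same as being normal. -/
theorem intNormal_iff_isNormal {t : Tm} (h : t.ParFree) (Γ : List Form) :
    IntNormal t ↔ IsNormal Γ t := by
  have key₁ : ∀ {Γ : List Form} {t t' : Tm}, Step Γ t t' → t.ParFree →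
      ∀ Δ : List Form, Compat (fun _ => Intuitionistic) Δ t t' := by
    intro Γ t t' hs
    unfold Step at hs
    induction hs with
    | base hb =>
      intro h Δ
      cases hb with
      | int h' => exact .base h'
      | perm h' => cases h' <;> simp [Tm.ParFree] at h
      | cross h' => cases h' <;> simp [Tm.ParFree] at h
    | lam _ ih => exact fun h Δ => .lam (ih h _)
    | appL _ ih => exact fun h Δ => .appL (ih h.1 _)
    | appR _ ih => exact fun h Δ => .appR (ih h.2 _)
    | pairL _ ih => exact fun h Δ => .pairL (ih h.1 _)
    | pairR _ ih => exact fun h Δ => .pairR (ih h.2 _)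
    | proj _ ih => exact fun h Δ => .proj (ih h _)
    | efq _ ih => exact fun h Δ => .efq (ih h _)
    | parL _ _ => exact fun h => h.elim
    | parR _ _ => exact fun h => h.elim
  have key₂ : ∀ {Γ : List Form} {t t' : Tm}, Compat (fun _ => Intuitionistic) Γ t t' →
      ∀ Δ : List Form, Step Δ t t' := by
    intro Γ t t' hs
    unfold Step
    induction hs with
    | base hb => exact fun Δ => .base (.int hb)
    | lam _ ih => exact fun Δ => .lam (ih _)
    | appL _ ih => exact fun Δ => .appL (ih _)
    | appR _ ih => exact fun Δ => .appR (ih _)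
    | pairL _ ih => exact fun Δ => .pairL (ih _)
    | pairR _ ih => exact fun Δ => .pairR (ih _)
    | proj _ ih => exact fun Δ => .proj (ih _)
    | efq _ ih => exact fun Δ => .efq (ih _)
    | parL _ ih => exact fun Δ => .parL (ih _)
    | parR _ ih => exact fun Δ => .parR (ih _)
  exact ⟨fun H t' hs => H t' (key₁ hs h []), fun H t' hs => H t' (key₂ hs Γ)⟩

end LambdaG

/-! The permutations that carry no complexity condition bring every term to a parallel form, so the
task is to normalize parallel forms. Simply typed terms have normal forms by a reducibility
argument; the difficulty is that a cross reduction creates a new communication variable and copies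
the old one. The proof controls the communication kinds by a set `S` of formulas that is closed
under subformulas and contains the proper subformulas of `A` and the strong subformulas of the types
of the free variables. A kind is low if the prime factors of both its components lie in `S`. A kind
that is not low has positive complexity (`posComm_of_not_lowIn`), so the restricted rules may be
applied to it.

Suppose that the kind of `a` is not low, but that the proper subformulas of its prime factors lie in
`S`. Then the type of `a` has its strong subformulas in `S`, and the subformula property of normal
simply typed terms (`Tm.Nf.subformula`) says that every occurrence of `a` is applied to an argument
and that all λ-bound variables have types in `S`. Hence a cross reduction is possible between two
normal components, and the kind of the new variable `b`, a conjunction of types of λ-bound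
variables, is low. The exception is the empty conjunction `⊤`; but then `b` is absent from one half
and the other half can be discarded. In each half one occurrence of `a` has been replaced, and
renormalizing does not multiply the remaining ones (`Ctx.exists_nf_count_lt`), so induction on the
number of occurrences removes `a` (`exists_lowIn_of_nf`). Permutations reduce compositions of
parallel forms to this case, and treating the operators from the inside out makes all kinds low
(`exists_lowIn`).

For arbitrary kinds, `S` is enlarged by all formulas with fewer than `c` symbols, and `c` is lowered
to `0` step by step: prime factors with fewer than `c + 1` symbols have proper subformulas with
fewer than `c`.

Low kinds need not have complexity zero, since the complexity refers to the variables that are free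
in the particular composition. If it is still positive somewhere, some prime factor in `S` is not
accounted for by `A` and these variables; deleting all such formulas gives a strictly smaller set,
with which that composition is normalized again. As `S` can be taken finite, this ends
(`exists_normalForm`). -/

namespace LambdaG

open Relation

/-! ### Renaming, substitution and free variables -/

theorem liftRen_comp (ρ ρ' : ℕ → ℕ) : liftRen (ρ' ∘ ρ) = liftRen ρ' ∘ liftRen ρ := by
  funext n; cases n <;> rfl

namespace Tm

theorem occurs_par {n : ℕ} {A B : Form} {u v : Tm} :
    (par A B u v).occurs n = (u.occurs (n + 1) || v.occurs (n + 1)) := rfl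

theorem occurs_var {n m : ℕ} : (var m).occurs n = true ↔ n = m := by
  simp [occurs]

theorem rename_congr {t : Tm} : ∀ {ρ ρ' : ℕ → ℕ},
    (∀ n, t.occurs n = true → ρ n = ρ' n) → t.rename ρ = t.rename ρ' := by
  have lift : ∀ {u : Tm} {ρ ρ' : ℕ → ℕ}, (∀ n, u.occurs (n + 1) = true → ρ n = ρ' n) →
      ∀ n, u.occurs n = true → liftRen ρ n = liftRen ρ' n := by
    intro u ρ ρ' h n hn
    cases n with
    | zero => rfl
    | succ n => simp [liftRen, h n hn]
  induction t with
  | var m => intro ρ ρ' h; simp [rename, h m (by simp [occurs])]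
  | lam A u ih => intro ρ ρ' h; simp only [rename]; rw [ih (lift h)]
  | app t u iht ihu | pair t u iht ihu =>
    intro ρ ρ' h
    simp only [rename]
    rw [iht fun n hn => h n (by simp [occurs, hn]), ihu fun n hn => h n (by simp [occurs, hn])]
  | proj i u ih | efq i u ih =>
    intro ρ ρ' h; simp only [rename]; rw [ih fun n hn => h n (by simpa [occurs] using hn)]
  | par A B u v ihu ihv =>
    intro ρ ρ' h
    simp only [rename]
    rw [ihu (lift fun n hn => h n (by simp [occurs, hn])),
      ihv (lift fun n hn => h n (by simp [occurs, hn]))]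

theorem rename_rename (t : Tm) : ∀ ρ ρ' : ℕ → ℕ,
    (t.rename ρ).rename ρ' = t.rename (ρ' ∘ ρ) := by
  induction t with
  | var m => intro ρ ρ'; rfl
  | lam A u ih => intro ρ ρ'; rw [rename, rename, rename, ih, liftRen_comp]
  | par A B u v ihu ihv => intro ρ ρ'; rw [rename, rename, rename, ihu, ihv, liftRen_comp]
  | app t u iht ihu | pair t u iht ihu =>
    intro ρ ρ'; rw [rename, rename, rename, iht, ihu]
  | proj i u ih | efq i u ih => intro ρ ρ'; rw [rename, rename, rename, ih]

theorem liftRen_id : liftRen id = id := by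
  funext n; cases n <;> rfl

theorem rename_id (t : Tm) : t.rename id = t := by
  induction t with
  | var m => rfl
  | _ => simp_all [rename, liftRen_id]

theorem exists_liftRen {p : ℕ → Prop} {ρ : ℕ → ℕ} {n : ℕ} :
    (∃ m, p m ∧ liftRen ρ m = n + 1) ↔ ∃ m, p (m + 1) ∧ ρ m = n := by
  constructor
  · rintro ⟨_ | m, h, e⟩
    · cases e
    · exact ⟨m, h, by simpa [liftRen] using e⟩
  · rintro ⟨m, h, e⟩
    exact ⟨m + 1, h, by simp [liftRen, e]⟩

theorem occurs_rename (t : Tm) : ∀ {ρ : ℕ → ℕ} {n : ℕ},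
    (t.rename ρ).occurs n = true ↔ ∃ m, t.occurs m = true ∧ ρ m = n := by
  induction t with
  | var m => intro ρ n; simp only [rename, occurs_var, exists_eq_left]; exact eq_comm
  | lam A u ih => intro ρ n; simp only [rename, occurs]; rw [ih, exists_liftRen]
  | app t u iht ihu | pair t u iht ihu =>
    intro ρ n
    simp only [rename, occurs, Bool.or_eq_true, iht, ihu, or_and_right, exists_or]
  | proj i u ih | efq i u ih => intro ρ n; simp only [rename, occurs, ih]
  | par A B u v ihu ihv =>
    intro ρ n
    simp only [rename, occurs, Bool.or_eq_true, ihu, ihv, exists_liftRen, or_and_right, exists_or]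

theorem occurs_shift_zero (t : Tm) : t.shift.occurs 0 = false := by
  rw [← Bool.not_eq_true, shift, occurs_rename]; simp

theorem occurs_shift_succ (t : Tm) (n : ℕ) : t.shift.occurs (n + 1) = t.occurs n := by
  rw [Bool.eq_iff_iff, shift, occurs_rename]; simp

theorem exists_eq_shift {t : Tm} (h : t.occurs 0 = false) : ∃ s : Tm, t = s.shift := by
  refine ⟨t.rename Nat.pred, ?_⟩
  rw [shift, rename_rename]
  conv_lhs => rw [← rename_id t]
  refine rename_congr fun n hn => ?_
  cases n with
  | zero => simp [h] at hn
  | succ n => rfl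

theorem liftSub_var : liftSub var = var := by
  funext n; cases n <;> rfl

theorem subst_var (t : Tm) : t.subst var = t := by
  induction t with
  | var m => rfl
  | _ => simp_all [subst, liftSub_var]

theorem subst_rename (t : Tm) : ∀ (ρ : ℕ → ℕ) (σ : ℕ → Tm),
    (t.rename ρ).subst σ = t.subst (σ ∘ ρ) := by
  have lift : ∀ (ρ : ℕ → ℕ) (σ : ℕ → Tm), liftSub σ ∘ liftRen ρ = liftSub (σ ∘ ρ) := by
    intro ρ σ; funext n; cases n <;> rfl
  induction t with
  | var m => intro ρ σ; rfl
  | _ => intro ρ σ; simp_all [rename, subst]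

theorem rename_subst (t : Tm) : ∀ (σ : ℕ → Tm) (ρ : ℕ → ℕ),
    (t.subst σ).rename ρ = t.subst fun n => (σ n).rename ρ := by
  have lift : ∀ (σ : ℕ → Tm) (ρ : ℕ → ℕ),
      (fun n => (liftSub σ n).rename (liftRen ρ)) = liftSub fun n => (σ n).rename ρ := by
    intro σ ρ; funext n
    cases n with
    | zero => rfl
    | succ n => simp only [liftSub, shift, rename_rename]; rfl
  induction t with
  | var m => intro σ ρ; rfl
  | _ => intro σ ρ; simp_all [rename, subst]

theorem subst_subst (t : Tm) : ∀ σ τ : ℕ → Tm,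
    (t.subst σ).subst τ = t.subst fun n => (σ n).subst τ := by
  have lift : ∀ σ τ : ℕ → Tm,
      (fun n => (liftSub σ n).subst (liftSub τ)) = liftSub fun n => (σ n).subst τ := by
    intro σ τ; funext n
    cases n with
    | zero => rfl
    | succ n => simp only [liftSub, shift, subst_rename, rename_subst]; rfl
  induction t with
  | var m => intro σ τ; rfl
  | _ => intro σ τ; simp_all [subst]

/-- The substitution of `t` for the innermost variable. -/
def single (t : Tm) : ℕ → Tm
  | 0 => t
  | m + 1 => var m

theorem inst_eq (u t : Tm) : u.inst t = u.subst (single t) := by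
  unfold inst; congr 1

theorem rename_inst (u t : Tm) (ρ : ℕ → ℕ) :
    (u.inst t).rename ρ = (u.rename (liftRen ρ)).inst (t.rename ρ) := by
  rw [inst_eq, inst_eq, rename_subst, subst_rename]
  congr 1; funext n; cases n <;> rfl

/-- A reducible abstraction is renamed before it is applied. This identity turns the contracted
redex into a single simultaneous substitution into the body, to which the induction hypothesis of
`HasType.red` applies. -/
theorem inst_subst_liftSub (u t : Tm) (σ : ℕ → Tm) (ρ : ℕ → ℕ) :
    ((u.subst (liftSub σ)).rename (liftRen ρ)).inst t =
      u.subst fun n => match n with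
        | 0 => t
        | m + 1 => (σ m).rename ρ := by
  rw [inst_eq, rename_subst, subst_subst]
  congr 1; funext n
  cases n with
  | zero => rfl
  | succ n =>
    simp only [liftSub, shift, rename_rename, subst_rename]
    conv_rhs => rw [← subst_var ((σ n).rename ρ), subst_rename]
    rfl

theorem occurs_subst (t : Tm) : ∀ {σ : ℕ → Tm} {n : ℕ},
    (t.subst σ).occurs n = true ↔ ∃ m, t.occurs m = true ∧ (σ m).occurs n = true := by
  have lift : ∀ {p : ℕ → Prop} {σ : ℕ → Tm} {n : ℕ},
      (∃ m, p m ∧ (liftSub σ m).occurs (n + 1) = true) ↔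
        ∃ m, p (m + 1) ∧ (σ m).occurs n = true := by
    intro p σ n
    constructor
    · rintro ⟨_ | m, h, e⟩
      · simp [liftSub, occurs] at e
      · exact ⟨m, h, by simpa [liftSub, occurs_shift_succ] using e⟩
    · rintro ⟨m, h, e⟩
      exact ⟨m + 1, h, by simpa [liftSub, occurs_shift_succ] using e⟩
  induction t with
  | var m => intro σ n; simp [subst, occurs]
  | lam A u ih => intro σ n; simp only [subst, occurs]; rw [ih, lift]
  | app t u iht ihu | pair t u iht ihu =>
    intro σ n
    simp only [subst, occurs, Bool.or_eq_true, iht, ihu, or_and_right, exists_or]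
  | proj i u ih | efq i u ih => intro σ n; simp only [subst, occurs, ih]
  | par A B u v ihu ihv =>
    intro σ n
    simp only [subst, occurs, Bool.or_eq_true, ihu, ihv, lift, or_and_right, exists_or]

theorem occurs_inst {u t : Tm} {n : ℕ} (h : (u.inst t).occurs n = true) :
    u.occurs (n + 1) = true ∨ t.occurs n = true := by
  rw [inst_eq, occurs_subst] at h
  obtain ⟨_ | m, hm, e⟩ := h
  · exact .inr e
  · rw [single, occurs_var] at e; subst e; exact .inl hm

theorem parFree_rename {t : Tm} : ∀ {ρ : ℕ → ℕ}, (t.rename ρ).ParFree ↔ t.ParFree := by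
  induction t <;> intro ρ <;> simp_all [rename, ParFree]

end Tm

/-! ### Typing -/

/-- Agreement of the two scopes is asked only at variables that occur. One statement thus covers
weakening, exchange and, read from left to right, strengthening, which is what discarding a
component requires. -/
theorem hasType_rename {t : Tm} : ∀ {Γ Δ : List Form} {ρ : ℕ → ℕ} {A : Form},
    (∀ n, t.occurs n = true → Δ[ρ n]? = Γ[n]?) →
      (HasType Δ (t.rename ρ) A ↔ HasType Γ t A) := by
  have lift : ∀ {u : Tm} {Γ Δ : List Form} {ρ : ℕ → ℕ} {B : Form},
      (∀ n, u.occurs (n + 1) = true → Δ[ρ n]? = Γ[n]?) →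
      ∀ n, u.occurs n = true → (B :: Δ)[liftRen ρ n]? = (B :: Γ)[n]? := by
    intro u Γ Δ ρ B h n hn
    cases n with
    | zero => rfl
    | succ n => simpa [liftRen] using h n hn
  induction t with
  | var m =>
    intro Γ Δ ρ A h
    have := h m (by simp [Tm.occurs])
    constructor
    · rintro ⟨e⟩; exact .var (this ▸ e)
    · rintro ⟨e⟩; exact .var (this.trans e)
  | lam B u ih =>
    intro Γ Δ ρ A h
    constructor
    · rintro (_ | hu); exact .lam ((ih (lift h)).1 ‹_›)
    · rintro (_ | hu); exact .lam ((ih (lift h)).2 ‹_›)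
  | app t u iht ihu =>
    intro Γ Δ ρ A h
    have ht := fun n (hn : t.occurs n = true) => h n (by simp [Tm.occurs, hn])
    have hu := fun n (hn : u.occurs n = true) => h n (by simp [Tm.occurs, hn])
    constructor
    · rintro (_ | _ | ⟨h₁, h₂⟩); exact .app ((iht ht).1 h₁) ((ihu hu).1 h₂)
    · rintro (_ | _ | ⟨h₁, h₂⟩); exact .app ((iht ht).2 h₁) ((ihu hu).2 h₂)
  | pair t u iht ihu =>
    intro Γ Δ ρ A h
    have ht := fun n (hn : t.occurs n = true) => h n (by simp [Tm.occurs, hn])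
    have hu := fun n (hn : u.occurs n = true) => h n (by simp [Tm.occurs, hn])
    constructor
    · rintro (_ | _ | _ | ⟨h₁, h₂⟩); exact .pair ((iht ht).1 h₁) ((ihu hu).1 h₂)
    · rintro (_ | _ | _ | ⟨h₁, h₂⟩); exact .pair ((iht ht).2 h₁) ((ihu hu).2 h₂)
  | proj i u ih =>
    intro Γ Δ ρ A h
    have hu := fun n hn => h n (by simpa [Tm.occurs] using hn)
    constructor
    · intro H
      cases H with
      | proj₀ H => exact .proj₀ ((ih hu).1 H)
      | proj₁ H => exact .proj₁ ((ih hu).1 H)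
    · intro H
      cases H with
      | proj₀ H => exact .proj₀ ((ih hu).2 H)
      | proj₁ H => exact .proj₁ ((ih hu).2 H)
  | efq P u ih =>
    intro Γ Δ ρ A h
    have hu := fun n hn => h n (by simpa [Tm.occurs] using hn)
    constructor
    · intro H; cases H with | efq H => exact .efq ((ih hu).1 H)
    · intro H; cases H with | efq H => exact .efq ((ih hu).2 H)
  | par B C u v ihu ihv =>
    intro Γ Δ ρ A h
    have hu := fun X => lift (u := u) (B := X) fun n hn => h n (by simp [Tm.occurs, hn])
    have hv := fun X => lift (u := v) (B := X) fun n hn => h n (by simp [Tm.occurs, hn])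
    constructor
    · intro H
      cases H with | par H₁ H₂ => exact .par ((ihu (hu _)).1 H₁) ((ihv (hv _)).1 H₂)
    · intro H
      cases H with | par H₁ H₂ => exact .par ((ihu (hu _)).2 H₁) ((ihv (hv _)).2 H₂)

theorem hasType_shift {Γ : List Form} {t : Tm} {A B : Form} :
    HasType (B :: Γ) t.shift A ↔ HasType Γ t A :=
  hasType_rename fun n _ => by simp

theorem HasType.subst {t : Tm} : ∀ {Γ Δ : List Form} {σ : ℕ → Tm} {A : Form},
    HasType Γ t A → (∀ n F, t.occurs n = true → Γ[n]? = some F → HasType Δ (σ n) F) →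
      HasType Δ (t.subst σ) A := by
  have lift : ∀ {u : Tm} {Γ Δ : List Form} {σ : ℕ → Tm} {B : Form},
      (∀ n F, u.occurs (n + 1) = true → Γ[n]? = some F → HasType Δ (σ n) F) →
      ∀ n F, u.occurs n = true → (B :: Γ)[n]? = some F →
        HasType (B :: Δ) (Tm.liftSub σ n) F := by
    intro u Γ Δ σ B h n F hn e
    cases n with
    | zero => exact .var (by simpa using e)
    | succ n => exact hasType_shift.2 (h n F hn (by simpa using e))
  intro Γ Δ σ A H
  induction H generalizing Δ σ with
  | @var Γ n A e => intro h; exact h n A (by simp [Tm.occurs]) e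
  | lam _ ih => intro h; exact .lam (ih (lift h))
  | app _ _ iht ihu =>
    intro h
    exact .app (iht fun n F hn => h n F (by simp [Tm.occurs, hn]))
      (ihu fun n F hn => h n F (by simp [Tm.occurs, hn]))
  | pair _ _ iht ihu =>
    intro h
    exact .pair (iht fun n F hn => h n F (by simp [Tm.occurs, hn]))
      (ihu fun n F hn => h n F (by simp [Tm.occurs, hn]))
  | proj₀ _ ih => intro h; exact .proj₀ (ih fun n F hn => h n F (by simpa [Tm.occurs] using hn))
  | proj₁ _ ih => intro h; exact .proj₁ (ih fun n F hn => h n F (by simpa [Tm.occurs] using hn))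
  | efq _ ih => intro h; exact .efq (ih fun n F hn => h n F (by simpa [Tm.occurs] using hn))
  | par _ _ ihu ihv =>
    intro h
    exact .par (ihu (lift fun n F hn => h n F (by simp [Tm.occurs, hn])))
      (ihv (lift fun n F hn => h n F (by simp [Tm.occurs, hn])))

theorem HasType.inst {Γ : List Form} {u t : Tm} {A B : Form} (hu : HasType (A :: Γ) u B)
    (ht : HasType Γ t A) : HasType Γ (u.inst t) B := by
  rw [Tm.inst_eq]
  refine hu.subst fun n F _ e => ?_
  cases n with
  | zero => simp at e; subst e; exact ht
  | succ n => exact .var (by simpa using e)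

/-- Abstractions and communication operators carry their types. Uniqueness makes the type quantified
in `PosComm` the type of the term, so that zero complexity at that type excludes `PosComm`. -/
theorem HasType.unique {Γ : List Form} {t : Tm} {A B : Form} (h : HasType Γ t A)
    (h' : HasType Γ t B) : A = B := by
  induction h generalizing B with
  | var e => cases h' with | var e' => exact Option.some.inj (e.symm.trans e')
  | lam _ ih => cases h' with | lam h' => rw [ih h']
  | app _ _ ih _ => cases h' with | app h' _ => exact (Form.imp.inj (ih h')).2
  | pair _ _ ih₁ ih₂ => cases h' with | pair h₁ h₂ => rw [ih₁ h₁, ih₂ h₂]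
  | proj₀ _ ih => cases h' with | proj₀ h' => exact (Form.and.inj (ih h')).1
  | proj₁ _ ih => cases h' with | proj₁ h' => exact (Form.and.inj (ih h')).2
  | efq _ _ => cases h' with | efq _ => rfl
  | par _ _ ih _ => cases h' with | par h' _ => exact ih h'

/-! ### Contexts -/

theorem iterate_liftRen (k : ℕ) (ρ : ℕ → ℕ) (n : ℕ) :
    liftRen^[k] ρ n = if n < k then n else ρ (n - k) + k := by
  induction k generalizing n with
  | zero => simp
  | succ k ih =>
    rw [Function.iterate_succ_apply']
    cases n with
    | zero => simp [liftRen]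
    | succ n =>
      simp only [liftRen, ih, Nat.add_lt_add_iff_right, Nat.add_sub_add_right]
      split <;> rfl

namespace Ctx

/-- The variable `n` occurs free in the context. -/
def occurs : ℕ → Ctx → Bool
  | _, hole => false
  | n, lam _ 𝒞 => occurs (n + 1) 𝒞
  | n, appL 𝒞 t => occurs n 𝒞 || t.occurs n
  | n, appR t 𝒞 => t.occurs n || occurs n 𝒞
  | n, pairL 𝒞 t => occurs n 𝒞 || t.occurs n
  | n, pairR t 𝒞 => t.occurs n || occurs n 𝒞
  | n, proj _ 𝒞 => occurs n 𝒞
  | n, efq _ 𝒞 => occurs n 𝒞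

theorem depth_lam (A : Form) (𝒞 : Ctx) : (lam A 𝒞).depth = 𝒞.depth + 1 := by
  simp [depth, binders]

theorem occurs_fill (𝒞 : Ctx) (s : Tm) : ∀ n : ℕ,
    (𝒞.fill s).occurs n = (𝒞.occurs n || s.occurs (n + 𝒞.depth)) := by
  induction 𝒞 with
  | hole => intro n; simp [fill, occurs, depth, binders]
  | lam A 𝒞 ih => intro n; simp only [fill, occurs, Tm.occurs, ih, depth_lam]; congr 2; ring
  | appL 𝒞 t ih | pairL 𝒞 t ih =>
    intro n
    simp only [fill, occurs, Tm.occurs, ih, depth, binders]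
    rw [Bool.or_right_comm]
  | appR t 𝒞 ih | pairR t 𝒞 ih =>
    intro n; simp only [fill, occurs, Tm.occurs, ih, depth, binders]; rw [Bool.or_assoc]
  | proj i 𝒞 ih | efq i 𝒞 ih =>
    intro n; simp only [fill, occurs, Tm.occurs, ih, depth, binders]

theorem binders_rename (𝒞 : Ctx) : ∀ ρ : ℕ → ℕ, (𝒞.rename ρ).binders = 𝒞.binders := by
  induction 𝒞 <;> intro ρ <;> simp_all [rename, binders]

theorem depth_rename (𝒞 : Ctx) (ρ : ℕ → ℕ) : (𝒞.rename ρ).depth = 𝒞.depth := by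
  rw [depth, binders_rename, depth]

theorem occurs_rename (𝒞 : Ctx) : ∀ {ρ : ℕ → ℕ} {n : ℕ},
    (𝒞.rename ρ).occurs n = true ↔ ∃ m, 𝒞.occurs m = true ∧ ρ m = n := by
  induction 𝒞 with
  | hole => intro ρ n; simp [rename, occurs]
  | lam A 𝒞 ih => intro ρ n; simp only [rename, occurs]; rw [ih, Tm.exists_liftRen]
  | appL 𝒞 t ih | appR 𝒞 t ih | pairL 𝒞 t ih | pairR 𝒞 t ih =>
    intro ρ n
    simp only [rename, occurs, Bool.or_eq_true, ih, Tm.occurs_rename, or_and_right, exists_or]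
  | proj i 𝒞 ih | efq i 𝒞 ih => intro ρ n; simp only [rename, occurs, ih]

theorem rename_fill (𝒞 : Ctx) (s : Tm) : ∀ ρ : ℕ → ℕ,
    (𝒞.fill s).rename ρ = (𝒞.rename ρ).fill (s.rename (liftRen^[𝒞.depth] ρ)) := by
  induction 𝒞 with
  | hole => intro ρ; rfl
  | lam A 𝒞 ih =>
    intro ρ
    simp only [rename, fill, Tm.rename]
    rw [ih, depth_lam, Function.iterate_succ_apply]
  | appL 𝒞 t ih | appR t 𝒞 ih | pairL 𝒞 t ih | pairR t 𝒞 ih | proj i 𝒞 ih | efq i 𝒞 ih =>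
    intro ρ
    simp only [rename, fill, Tm.rename]
    rw [ih]; rfl

theorem occurs_fillComm (𝒞 : Ctx) (u : Tm) (n : ℕ) :
    (𝒞.fillComm u).occurs (n + 1) = (𝒞.occurs (n + 1) || u.occurs (𝒞.depth + 1 + n)) := by
  rw [fillComm, occurs_fill, Tm.occurs, Tm.occurs, show n + 1 + 𝒞.depth = 𝒞.depth + 1 + n by ring]
  have : (𝒞.depth + 1 + n == 𝒞.depth) = false := by simp; omega
  rw [this, Bool.false_or]

/-- Besides the type `F` of the hole, this gives the right to refill the hole after the free
variables of the context have been moved to another scope. A cross reduction needs both at once,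
since it inserts `b` between `a` and the outer variables. -/
theorem hasType_fill (𝒞 : Ctx) {s : Tm} : ∀ {Γ : List Form} {A : Form},
    HasType Γ (𝒞.fill s) A → ∃ F, HasType (𝒞.binders ++ Γ) s F ∧
      ∀ (Δ : List Form) (ρ : ℕ → ℕ) (s' : Tm),
        (∀ n, 𝒞.occurs n = true → Δ[ρ n]? = Γ[n]?) →
        HasType (𝒞.binders ++ Δ) s' F → HasType Δ ((𝒞.rename ρ).fill s') A := by
  induction 𝒞 with
  | hole => intro Γ A h; exact ⟨A, h, fun _ _ _ _ h => h⟩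
  | lam B 𝒞 ih =>
    intro Γ A h
    cases h with
    | lam h =>
    obtain ⟨F, h₁, h₂⟩ := ih h
    refine ⟨F, by simpa [binders] using h₁, fun Δ ρ s' hρ hs => .lam (h₂ _ _ _ ?_ ?_)⟩
    · intro n hn
      cases n with
      | zero => rfl
      | succ n => simpa [liftRen] using hρ n hn
    · simpa [binders] using hs
  | appL 𝒞 t ih =>
    intro Γ A h
    cases h with
    | app h ht =>
    obtain ⟨F, h₁, h₂⟩ := ih h
    exact ⟨F, h₁, fun Δ ρ s' hρ hs => .app (h₂ _ _ _ (fun n hn => hρ n (by simp [occurs, hn])) hs)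
      ((hasType_rename fun n hn => hρ n (by simp [occurs, hn])).2 ht)⟩
  | appR t 𝒞 ih =>
    intro Γ A h
    cases h with
    | app ht h =>
    obtain ⟨F, h₁, h₂⟩ := ih h
    exact ⟨F, h₁, fun Δ ρ s' hρ hs =>
      .app ((hasType_rename fun n hn => hρ n (by simp [occurs, hn])).2 ht)
        (h₂ _ _ _ (fun n hn => hρ n (by simp [occurs, hn])) hs)⟩
  | pairL 𝒞 t ih =>
    intro Γ A h
    cases h with
    | pair h ht =>
    obtain ⟨F, h₁, h₂⟩ := ih h
    exact ⟨F, h₁, fun Δ ρ s' hρ hs => .pair (h₂ _ _ _ (fun n hn => hρ n (by simp [occurs, hn])) hs)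
      ((hasType_rename fun n hn => hρ n (by simp [occurs, hn])).2 ht)⟩
  | pairR t 𝒞 ih =>
    intro Γ A h
    cases h with
    | pair ht h =>
    obtain ⟨F, h₁, h₂⟩ := ih h
    exact ⟨F, h₁, fun Δ ρ s' hρ hs =>
      .pair ((hasType_rename fun n hn => hρ n (by simp [occurs, hn])).2 ht)
        (h₂ _ _ _ (fun n hn => hρ n (by simp [occurs, hn])) hs)⟩
  | proj i 𝒞 ih =>
    intro Γ A h
    cases h with
    | proj₀ h =>
      obtain ⟨F, h₁, h₂⟩ := ih h
      exact ⟨F, h₁, fun Δ ρ s' hρ hs => .proj₀ (h₂ _ _ _ hρ hs)⟩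
    | proj₁ h =>
      obtain ⟨F, h₁, h₂⟩ := ih h
      exact ⟨F, h₁, fun Δ ρ s' hρ hs => .proj₁ (h₂ _ _ _ hρ hs)⟩
  | efq P 𝒞 ih =>
    intro Γ A h
    cases h with
    | efq h =>
    obtain ⟨F, h₁, h₂⟩ := ih h
    exact ⟨F, h₁, fun Δ ρ s' hρ hs => .efq (h₂ _ _ _ hρ hs)⟩

theorem mem_boundVars {𝒞 : Ctx} {u : Tm} {p : Form × ℕ} :
    p ∈ 𝒞.boundVars u ↔ 𝒞.binders[p.2]? = some p.1 ∧ u.occurs p.2 = true := by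
  simp [boundVars, List.mem_zipIdx_iff_getElem?]

theorem snd_lt_depth {𝒞 : Ctx} {u : Tm} {n : ℕ} (h : n ∈ (𝒞.boundVars u).map Prod.snd) :
    n < 𝒞.depth := by
  obtain ⟨p, hp, rfl⟩ := List.mem_map.1 h
  exact (List.getElem?_eq_some_iff.1 (mem_boundVars.1 hp).1).1

theorem mem_map_snd_boundVars {𝒞 : Ctx} {u : Tm} {n : ℕ} (h : n < 𝒞.depth)
    (hn : u.occurs n = true) : n ∈ (𝒞.boundVars u).map Prod.snd :=
  List.mem_map.2 ⟨(𝒞.binders[n]'h, n), mem_boundVars.2 ⟨List.getElem?_eq_getElem h, hn⟩, rfl⟩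

end Ctx

/-! ### Tuples and migration -/

theorem hasType_tupleVars {Γ : List Form} : ∀ {y : List (Form × ℕ)},
    (∀ p ∈ y, Γ[p.2]? = some p.1) → HasType Γ (tupleVars y) (conjTypes y)
  | [], _ => .lam (.var rfl)
  | [p], h => .var (h p (by simp))
  | p :: q :: l, h =>
    .pair (.var (h p (by simp))) (hasType_tupleVars (y := q :: l) fun r hr => h r (by simp [hr]))

theorem occurs_tupleVars {n : ℕ} : ∀ {y : List (Form × ℕ)},
    (tupleVars y).occurs n = true → n ∈ y.map Prod.snd
  | [], h => by simp [tupleVars, Tm.tuple, Tm.occurs] at h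
  | [p], h => by
    have : n = p.2 := Tm.occurs_var.1 h
    simp [this]
  | p :: q :: l, h => by
    have h : ((Tm.var p.2).occurs n || (tupleVars (q :: l)).occurs n) = true := h
    rw [Bool.or_eq_true, Tm.occurs_var] at h
    rw [List.map_cons, List.mem_cons]
    exact h.imp id occurs_tupleVars

theorem hasType_nthProj {Γ : List Form} {F : Form} : ∀ {L : List Form} {i : ℕ} {t : Tm},
    HasType Γ t (Form.conj L) → L[i]? = some F → HasType Γ (Tm.nthProj L.length i t) F
  | [_], 0, t, h, e => by simp at e; subst e; exact h
  | A :: B :: l, 0, t, h, e => by simp at e; subst e; exact .proj₀ h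
  | A :: B :: l, i + 1, t, h, e =>
    hasType_nthProj (L := B :: l) (t := .proj true t) (.proj₁ h) (by simpa using e)

theorem occurs_nthProj {m : ℕ} : ∀ {n i : ℕ} {t : Tm},
    (Tm.nthProj n i t).occurs m = t.occurs m
  | 0, _, _ => rfl
  | 1, _, _ => rfl
  | _ + 2, 0, _ => rfl
  | n + 2, i + 1, t => by rw [Tm.nthProj, occurs_nthProj]; rfl

/-- A variable of `u` is bound in the context, and then listed and replaced by a projection of
`b⟨z⟩` of the same type, or it is an outer variable. The only other candidate is `a`, which `hr`
excludes; this is why the types `X`, `Y` of `a` on the two sides do not matter. -/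
theorem hasType_migrate {Γ : List Form} {X Y F : Form} {𝒞 𝒟 : Ctx} {u v : Tm}
    (hu : HasType (𝒞.binders ++ X :: Γ) u F) (hr : u.occurs 𝒞.depth = false) :
    HasType
      (𝒟.binders ++ Y :: .imp (conjTypes (𝒟.boundVars v)) (conjTypes (𝒞.boundVars u)) :: Γ)
      (migrate 𝒞.depth 𝒟.depth (𝒞.boundVars u) (𝒟.boundVars v) u) F := by
  refine hu.subst fun n G hn e => ?_
  split_ifs with hy
  · have hlt : n < 𝒞.binders.length := Ctx.snd_lt_depth hy
    have e' : 𝒞.binders[n]? = some G := by rwa [List.getElem?_append_left hlt] at e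
    have hi := List.idxOf_lt_length_of_mem hy
    have hi' : ((𝒞.boundVars u).map Prod.snd).idxOf n < (𝒞.boundVars u).length := by
      simpa using hi
    have h₂ : (𝒞.boundVars u)[((𝒞.boundVars u).map Prod.snd).idxOf n].2 = n := by
      have := List.getElem_idxOf hi
      rwa [List.getElem_map] at this
    have h₁ := (Ctx.mem_boundVars.1 (List.getElem_mem hi')).1
    rw [h₂, e'] at h₁
    have := hasType_nthProj (F := G)
      (Γ := 𝒟.binders ++ Y ::
        .imp (conjTypes (𝒟.boundVars v)) (conjTypes (𝒞.boundVars u)) :: Γ)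
      (L := (𝒞.boundVars u).map Prod.fst)
      (i := ((𝒞.boundVars u).map Prod.snd).idxOf n)
      (t := .app (.var (𝒟.depth + 1)) (tupleVars (𝒟.boundVars v)))
      (.app (.var (by
        rw [List.getElem?_append_right (by simp [Ctx.depth])]; simp [Ctx.depth]; rfl))
        (hasType_tupleVars fun p hp => by
          have hp := (Ctx.mem_boundVars.1 hp).1
          rw [List.getElem?_append_left (List.getElem?_eq_some_iff.1 hp).1, hp]))
      (by rw [List.getElem?_map, List.getElem?_eq_getElem hi']; exact h₁.symm)
    rwa [List.length_map] at this
  · have h₁ : 𝒞.depth < n := by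
      rcases lt_trichotomy n 𝒞.depth with h | h | h
      · exact absurd (Ctx.mem_map_snd_boundVars h hn) hy
      · subst h; simp [hr] at hn
      · exact h
    obtain ⟨j, rfl⟩ := Nat.exists_eq_add_of_lt h₁
    rw [List.getElem?_append_right (by simp [Ctx.depth]; omega)] at e
    have e : Γ[j]? = some G := by
      rw [show 𝒞.depth + j + 1 - 𝒞.binders.length = j + 1 by simp [Ctx.depth]; omega] at e
      simpa using e
    -- The outer variable `j` has index `j + 1` behind `a`, and index `j + 2` in the new scope,
    -- where both `a` and `b` precede it.
    refine .var ?_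
    rw [List.getElem?_append_right (by simp [Ctx.depth]; omega),
      show 𝒞.depth + j + 1 + 𝒟.depth + 1 - 𝒞.depth - 𝒟.binders.length = j + 2 by
        simp [Ctx.depth]; omega]
    simpa using e

/-- The free variables of `u^{b⟨z⟩/y}` at the hole are bound there, or `b`, or outer variables
of `u`. -/
theorem occurs_migrate {𝒞 𝒟 : Ctx} {u v : Tm} {q : ℕ} (hr : u.occurs 𝒞.depth = false)
    (h : (migrate 𝒞.depth 𝒟.depth (𝒞.boundVars u) (𝒟.boundVars v) u).occurs (q + 𝒟.depth) = true) :
    (q = 1 ∧ 𝒞.boundVars u ≠ []) ∨ ∃ j, q = j + 2 ∧ u.occurs (𝒞.depth + 1 + j) = true := by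
  rw [migrate, Tm.occurs_subst] at h
  obtain ⟨n, hn, h⟩ := h
  split_ifs at h with hy
  · rw [occurs_nthProj, Tm.occurs, Bool.or_eq_true, Tm.occurs_var] at h
    left
    refine ⟨?_, fun h0 => by simp [h0] at hy⟩
    rcases h with h | h
    · omega
    · have := Ctx.snd_lt_depth (occurs_tupleVars h); omega
  · right
    have h₁ : 𝒞.depth < n := by
      rcases lt_trichotomy n 𝒞.depth with h | h | h
      · exact absurd (Ctx.mem_map_snd_boundVars h hn) hy
      · subst h; simp [hr] at hn
      · exact h
    obtain ⟨j, rfl⟩ := Nat.exists_eq_add_of_lt h₁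
    rw [Tm.occurs_var] at h
    refine ⟨j, by omega, ?_⟩
    rwa [show 𝒞.depth + 1 + j = 𝒞.depth + j + 1 by ring]

/-! ### Subject reduction -/

theorem getElem?_liftRen_succ {X Y : Form} {Γ : List Form} (n : ℕ) :
    (X :: Y :: Γ)[liftRen Nat.succ n]? = (X :: Γ)[n]? := by
  cases n <;> simp [liftRen]

theorem getElem?_swapRen {X Y : Form} {Γ : List Form} (n : ℕ) :
    (X :: Y :: Γ)[swapRen n]? = (Y :: X :: Γ)[n]? := by
  rcases n with _ | _ | n <;> simp [swapRen]

theorem hasType_liftRen_succ {X Y A : Form} {Γ : List Form} {t : Tm} :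
    HasType (X :: Y :: Γ) (t.rename (liftRen Nat.succ)) A ↔ HasType (X :: Γ) t A :=
  hasType_rename fun n _ => getElem?_liftRen_succ n

theorem hasType_swapRen {X Y A : Form} {Γ : List Form} {t : Tm} :
    HasType (X :: Y :: Γ) (t.rename swapRen) A ↔ HasType (Y :: X :: Γ) t A :=
  hasType_rename fun n _ => getElem?_swapRen n

/-- In `𝒞` the variable `a : A → B` has an argument `u : A`. In `𝒟` it has type `B → A`, so the hole
that held `a v` expects precisely type `A`. -/
theorem hasType_fill_migrate {Γ : List Form} {A B C : Form} {𝒞 𝒟 : Ctx} {u v : Tm}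
    (hC : HasType (.imp A B :: Γ) (𝒞.fillComm u) C)
    (hD : HasType (.imp B A :: Γ) (𝒟.fillComm v) C) (hr : u.occurs 𝒞.depth = false) :
    HasType (.imp B A :: .imp (conjTypes (𝒟.boundVars v)) (conjTypes (𝒞.boundVars u)) :: Γ)
      ((𝒟.rename (liftRen Nat.succ)).fill
        (migrate 𝒞.depth 𝒟.depth (𝒞.boundVars u) (𝒟.boundVars v) u)) C := by
  have hole : ∀ {ℰ : Ctx} {w : Tm} {D E G : Form},
      HasType (ℰ.binders ++ .imp D E :: Γ) (.app (.var ℰ.depth) w) G →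
        G = E ∧ HasType (ℰ.binders ++ .imp D E :: Γ) w D := by
    intro ℰ w D E G h
    cases h with
    | app h₁ h₂ =>
    cases h₁ with
    | var e =>
    simp [Ctx.depth] at e
    obtain ⟨rfl, rfl⟩ := e
    exact ⟨rfl, h₂⟩
  obtain ⟨F, h₁, -⟩ := 𝒞.hasType_fill hC
  obtain ⟨G, h₃, h₄⟩ := 𝒟.hasType_fill hD
  obtain ⟨rfl, h₁⟩ := hole h₁
  obtain ⟨rfl, -⟩ := hole h₃
  exact h₄ _ _ _ (fun n _ => getElem?_liftRen_succ n) (hasType_migrate h₁ hr)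

theorem Intuitionistic.hasType {Γ : List Form} {t t' : Tm} (h : Intuitionistic t t') {A : Form}
    (ht : HasType Γ t A) : HasType Γ t' A := by
  cases h with
  | beta B u s => cases ht with | app h₁ h₂ => cases h₁ with | lam h₁ => exact h₁.inst h₂
  | proj₀ => cases ht with | proj₀ h => cases h with | pair h _ => exact h
  | proj₁ => cases ht with | proj₁ h => cases h with | pair _ h => exact h

theorem Permutation.hasType {Γ : List Form} {t t' : Tm} (h : Permutation Γ t t') {A : Form}
    (ht : HasType Γ t A) : HasType Γ t' A := by
  cases h with
  | appL =>
    cases ht with | app h w => cases h with | par u v =>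
    exact .par (.app u (hasType_shift.2 w)) (.app v (hasType_shift.2 w))
  | appR =>
    cases ht with | app w h => cases h with | par u v =>
    exact .par (.app (hasType_shift.2 w) u) (.app (hasType_shift.2 w) v)
  | efq => cases ht with | efq h => cases h with | par u v => exact .par (.efq u) (.efq v)
  | proj =>
    cases ht with
    | proj₀ h => cases h with | par u v => exact .par (.proj₀ u) (.proj₀ v)
    | proj₁ h => cases h with | par u v => exact .par (.proj₁ u) (.proj₁ v)
  | lam =>
    cases ht with | lam h => cases h with | par u v =>
    exact .par (.lam (hasType_swapRen.2 u)) (.lam (hasType_swapRen.2 v))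
  | pairL =>
    cases ht with | pair h w => cases h with | par u v =>
    exact .par (.pair u (hasType_shift.2 w)) (.pair v (hasType_shift.2 w))
  | pairR =>
    cases ht with | pair w h => cases h with | par u v =>
    exact .par (.pair (hasType_shift.2 w) u) (.pair (hasType_shift.2 w) v)
  | parL =>
    cases ht with | par h w => cases h with | par u v =>
    exact .par (.par (hasType_swapRen.2 u) (hasType_liftRen_succ.2 w))
      (.par (hasType_swapRen.2 v) (hasType_liftRen_succ.2 w))
  | parR =>
    cases ht with | par w h => cases h with | par u v =>
    exact .par (.par (hasType_liftRen_succ.2 w) (hasType_swapRen.2 u))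
      (.par (hasType_liftRen_succ.2 w) (hasType_swapRen.2 v))

theorem Cross.hasType {Γ : List Form} {t t' : Tm} (h : Cross Γ t t') {A : Form}
    (ht : HasType Γ t A) : HasType Γ t' A := by
  cases h with
  | left => cases ht with | par h _ => exact hasType_shift.1 h
  | right => cases ht with | par _ h => exact hasType_shift.1 h
  | cross A B 𝒞 𝒟 u v y z _ _ _ _ hu hv hy hz _ =>
    subst hy hz
    cases ht with | par h₁ h₂ =>
    exact .par (.par (hasType_fill_migrate h₁ h₂ hu.2) (hasType_liftRen_succ.2 h₁))
      (.par (hasType_fill_migrate h₂ h₁ hv.2) (hasType_liftRen_succ.2 h₂))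

theorem Step.hasType {Γ : List Form} {t t' : Tm} (h : Step Γ t t') : ∀ {A : Form},
    HasType Γ t A → HasType Γ t' A := by
  unfold Step at h
  induction h with
  | base h =>
    intro A ht
    cases h with
    | int h => exact h.hasType ht
    | perm h => exact h.hasType ht
    | cross h => exact h.hasType ht
  | lam _ ih => intro A ht; cases ht with | lam h => exact .lam (ih h)
  | appL _ ih => intro A ht; cases ht with | app h h' => exact .app (ih h) h'
  | appR _ ih => intro A ht; cases ht with | app h h' => exact .app h (ih h')
  | pairL _ ih => intro A ht; cases ht with | pair h h' => exact .pair (ih h) h'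
  | pairR _ ih => intro A ht; cases ht with | pair h h' => exact .pair h (ih h')
  | proj _ ih =>
    intro A ht
    cases ht with
    | proj₀ h => exact .proj₀ (ih h)
    | proj₁ h => exact .proj₁ (ih h)
  | efq _ ih => intro A ht; cases ht with | efq h => exact .efq (ih h)
  | parL _ ih => intro A ht; cases ht with | par h h' => exact .par (ih h) h'
  | parR _ ih => intro A ht; cases ht with | par h h' => exact .par h (ih h')

/-! ### Reduction does not create free variables -/

theorem occurs_liftRen_succ {t : Tm} {n : ℕ} :
    (t.rename (liftRen Nat.succ)).occurs (n + 2) = t.occurs (n + 1) := by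
  rw [Bool.eq_iff_iff, Tm.occurs_rename]
  constructor
  · rintro ⟨_ | m, h, e⟩
    · cases e
    · simp [liftRen] at e; subst e; exact h
  · exact fun h => ⟨n + 1, h, rfl⟩

theorem occurs_swapRen {t : Tm} {n : ℕ} :
    (t.rename swapRen).occurs (n + 2) = t.occurs (n + 2) := by
  rw [Bool.eq_iff_iff, Tm.occurs_rename]
  constructor
  · rintro ⟨_ | _ | m, h, e⟩
    · cases e
    · cases e
    · simp [swapRen] at e; subst e; exact h
  · exact fun h => ⟨n + 2, h, rfl⟩

theorem occurs_fill_migrate {𝒞 𝒟 : Ctx} {u v : Tm} {n : ℕ} (hr : u.occurs 𝒞.depth = false)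
    (h : ((𝒟.rename (liftRen Nat.succ)).fill
        (migrate 𝒞.depth 𝒟.depth (𝒞.boundVars u) (𝒟.boundVars v) u)).occurs (n + 2) = true) :
    (𝒞.fillComm u).occurs (n + 1) = true ∨ (𝒟.fillComm v).occurs (n + 1) = true := by
  rw [Ctx.occurs_fill, Bool.or_eq_true, Ctx.occurs_rename, Ctx.depth_rename] at h
  rw [Ctx.occurs_fillComm, Ctx.occurs_fillComm, Bool.or_eq_true, Bool.or_eq_true]
  rcases h with ⟨_ | m, h, e⟩ | h
  · cases e
  · simp [liftRen] at e; subst e; exact .inr (.inl h)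
  · rcases occurs_migrate hr h with ⟨h, -⟩ | ⟨j, hj, h⟩
    · omega
    · obtain rfl : n = j := by omega
      exact .inl (.inr h)

theorem Basic.occurs {Γ : List Form} {t t' : Tm} (h : Basic Γ t t') {n : ℕ}
    (hn : t'.occurs n = true) : t.occurs n = true := by
  cases h with
  | int h =>
    cases h with
    | beta A u s => simpa [Tm.occurs] using Tm.occurs_inst hn
    | proj₀ | proj₁ => simp [Tm.occurs, hn]
  | perm h =>
    cases h <;>
      simp only [Tm.occurs, Tm.occurs_shift_succ, occurs_swapRen, occurs_liftRen_succ,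
        Bool.or_eq_true] at hn ⊢ <;> tauto
  | cross h =>
    cases h with
    | left => simp [Tm.occurs, Tm.occurs_shift_succ, hn]
    | right => simp [Tm.occurs, Tm.occurs_shift_succ, hn]
    | cross A B 𝒞 𝒟 u v y z _ _ _ _ hu hv hy hz _ =>
      subst hy hz
      simp only [Tm.occurs_par, occurs_liftRen_succ, Bool.or_eq_true] at hn ⊢
      rcases hn with (h | h) | (h | h)
      · exact occurs_fill_migrate hu.2 h
      · exact .inl h
      · exact (occurs_fill_migrate hv.2 h).symm
      · exact .inr h

theorem Step.occurs {Γ : List Form} {t t' : Tm} (h : Step Γ t t') : ∀ {n : ℕ},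
    t'.occurs n = true → t.occurs n = true := by
  unfold Step at h
  induction h with
  | base h => exact h.occurs
  | lam _ ih | proj _ ih | efq _ ih => intro n hn; exact ih hn
  | _ =>
    intro n
    simp only [Tm.occurs, Bool.or_eq_true]
    rintro (h | h) <;> simp_all

/-- Reduction in finitely many steps. -/
abbrev Steps (Γ : List Form) : Tm → Tm → Prop := ReflTransGen (Step Γ)

theorem Steps.hasType {Γ : List Form} {t t' : Tm} (h : Steps Γ t t') {A : Form}
    (ht : HasType Γ t A) : HasType Γ t' A := by
  induction h with
  | refl => exact ht
  | tail _ h ih => exact h.hasType ih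

theorem Steps.occurs {Γ : List Form} {t t' : Tm} (h : Steps Γ t t') {n : ℕ}
    (hn : t'.occurs n = true) : t.occurs n = true := by
  induction h with
  | refl => exact hn
  | tail _ h ih => exact ih (h.occurs hn)

theorem Steps.lam {Γ : List Form} {A : Form} {u u' : Tm} (h : Steps (A :: Γ) u u') :
    Steps Γ (.lam A u) (.lam A u') :=
  h.lift (Tm.lam A) fun _ _ => .lam

theorem Steps.app {Γ : List Form} {t t' u u' : Tm} (h : Steps Γ t t') (h' : Steps Γ u u') :
    Steps Γ (.app t u) (.app t' u') :=
  (h.lift (Tm.app · u) fun _ _ => .appL).trans (h'.lift (Tm.app t') fun _ _ => .appR)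

theorem Steps.pair {Γ : List Form} {t t' u u' : Tm} (h : Steps Γ t t') (h' : Steps Γ u u') :
    Steps Γ (.pair t u) (.pair t' u') :=
  (h.lift (Tm.pair · u) fun _ _ => .pairL).trans (h'.lift (Tm.pair t') fun _ _ => .pairR)

theorem Steps.proj {Γ : List Form} {i : Bool} {u u' : Tm} (h : Steps Γ u u') :
    Steps Γ (.proj i u) (.proj i u') :=
  h.lift (Tm.proj i) fun _ _ => .proj

theorem Steps.efq {Γ : List Form} {P : ℕ} {u u' : Tm} (h : Steps Γ u u') :
    Steps Γ (.efq P u) (.efq P u') :=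
  h.lift (Tm.efq P) fun _ _ => .efq

theorem Steps.par {Γ : List Form} {A B : Form} {u u' v v' : Tm}
    (h : Steps (.imp A B :: Γ) u u') (h' : Steps (.imp B A :: Γ) v v') :
    Steps Γ (.par A B u v) (.par A B u' v') :=
  (h.lift (Tm.par A B · v) fun _ _ => .parL).trans (h'.lift (Tm.par A B u') fun _ _ => .parR)

/-! ### Intuitionistic normal forms -/

/-- One intuitionistic reduction step, anywhere in the term. -/
def IStep (t t' : Tm) : Prop := Compat (fun _ => Intuitionistic) [] t t'

/-- Finitely many intuitionistic reduction steps. -/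
abbrev ISteps : Tm → Tm → Prop := ReflTransGen IStep

/-- For intuitionistic rules the list of types is a dummy. Reductions can therefore pass under
binders although `IStep` fixes the empty list. -/
theorem compat_intuitionistic {Γ : List Form} {t t' : Tm}
    (h : Compat (fun _ => Intuitionistic) Γ t t') :
    ∀ Δ : List Form, Compat (fun _ => Intuitionistic) Δ t t' := by
  induction h with
  | base h => exact fun _ => .base h
  | lam _ ih => exact fun _ => .lam (ih _)
  | appL _ ih => exact fun _ => .appL (ih _)
  | appR _ ih => exact fun _ => .appR (ih _)
  | pairL _ ih => exact fun _ => .pairL (ih _)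
  | pairR _ ih => exact fun _ => .pairR (ih _)
  | proj _ ih => exact fun _ => .proj (ih _)
  | efq _ ih => exact fun _ => .efq (ih _)
  | parL _ ih => exact fun _ => .parL (ih _)
  | parR _ ih => exact fun _ => .parR (ih _)

theorem IStep.step {t t' : Tm} (h : IStep t t') (Γ : List Form) : Step Γ t t' := by
  have h := compat_intuitionistic h Γ
  unfold Step
  clear * - h
  induction h with
  | base h => exact .base (.int h)
  | lam _ ih => exact .lam ih
  | appL _ ih => exact .appL ih
  | appR _ ih => exact .appR ih
  | pairL _ ih => exact .pairL ih
  | pairR _ ih => exact .pairR ih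
  | proj _ ih => exact .proj ih
  | efq _ ih => exact .efq ih
  | parL _ ih => exact .parL ih
  | parR _ ih => exact .parR ih

theorem ISteps.steps {t t' : Tm} (h : ISteps t t') (Γ : List Form) : Steps Γ t t' :=
  h.lift id fun _ _ h => h.step Γ

theorem IStep.lam {A : Form} {u u' : Tm} (h : IStep u u') : IStep (.lam A u) (.lam A u') :=
  Compat.lam (compat_intuitionistic h _)

theorem ISteps.lam {A : Form} {u u' : Tm} (h : ISteps u u') : ISteps (.lam A u) (.lam A u') :=
  h.lift (Tm.lam A) fun _ _ => IStep.lam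

theorem ISteps.app {t t' u u' : Tm} (h : ISteps t t') (h' : ISteps u u') :
    ISteps (.app t u) (.app t' u') :=
  (h.lift (Tm.app · u) fun _ _ => Compat.appL).trans (h'.lift (Tm.app t') fun _ _ => Compat.appR)

theorem ISteps.pair {t t' u u' : Tm} (h : ISteps t t') (h' : ISteps u u') :
    ISteps (.pair t u) (.pair t' u') :=
  (h.lift (Tm.pair · u) fun _ _ => Compat.pairL).trans
    (h'.lift (Tm.pair t') fun _ _ => Compat.pairR)

theorem ISteps.proj {i : Bool} {u u' : Tm} (h : ISteps u u') :
    ISteps (.proj i u) (.proj i u') :=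
  h.lift (Tm.proj i) fun _ _ => Compat.proj

theorem ISteps.efq {P : ℕ} {u u' : Tm} (h : ISteps u u') : ISteps (.efq P u) (.efq P u') :=
  h.lift (Tm.efq P) fun _ _ => Compat.efq

theorem IStep.rename {t t' : Tm} (h : IStep t t') (ρ : ℕ → ℕ) :
    IStep (t.rename ρ) (t'.rename ρ) := by
  unfold IStep at h ⊢
  generalize [] = Γ at h ⊢
  induction h generalizing ρ with
  | base h =>
    refine .base ?_
    cases h with
    | beta A u s => rw [Tm.rename_inst]; exact .beta _ _ _
    | proj₀ => exact .proj₀ _ _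
    | proj₁ => exact .proj₁ _ _
  | lam _ ih => exact .lam (compat_intuitionistic (ih _) _)
  | appL _ ih => exact .appL (ih _)
  | appR _ ih => exact .appR (ih _)
  | pairL _ ih => exact .pairL (ih _)
  | pairR _ ih => exact .pairR (ih _)
  | proj _ ih => exact .proj (ih _)
  | efq _ ih => exact .efq (ih _)
  | parL _ ih => exact .parL (compat_intuitionistic (ih _) _)
  | parR _ ih => exact .parR (compat_intuitionistic (ih _) _)

theorem ISteps.rename {t t' : Tm} (h : ISteps t t') (ρ : ℕ → ℕ) :
    ISteps (t.rename ρ) (t'.rename ρ) :=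
  h.lift (Tm.rename ρ) fun _ _ h => h.rename ρ

namespace Tm

/-- The term is neither an abstraction nor a pair. -/
def Neutral (t : Tm) : Prop := (∀ A s, t ≠ lam A s) ∧ ∀ s s', t ≠ pair s s'

/-- Simply typed terms without intuitionistic redexes. -/
def Nf : Tm → Prop
  | var _ => True
  | lam _ u => Nf u
  | app t u => Nf t ∧ Nf u ∧ ∀ A s, t ≠ lam A s
  | pair u t => Nf u ∧ Nf t
  | proj _ u => Nf u ∧ ∀ s s', u ≠ pair s s'
  | efq _ u => Nf u
  | par _ _ _ _ => False

theorem neutral_var (n : ℕ) : (var n).Neutral := ⟨by simp, by simp⟩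

theorem neutral_app (t u : Tm) : (app t u).Neutral := ⟨by simp, by simp⟩

theorem neutral_proj (i : Bool) (u : Tm) : (proj i u).Neutral := ⟨by simp, by simp⟩

theorem forall_rename_ne_lam {t : Tm} {ρ : ℕ → ℕ} :
    (∀ A s, t.rename ρ ≠ lam A s) ↔ ∀ A s, t ≠ lam A s := by
  cases t <;> simp [rename]

theorem forall_rename_ne_pair {t : Tm} {ρ : ℕ → ℕ} :
    (∀ s s', t.rename ρ ≠ pair s s') ↔ ∀ s s', t ≠ pair s s' := by
  cases t <;> simp [rename]

theorem nf_rename {t : Tm} : ∀ {ρ : ℕ → ℕ}, (t.rename ρ).Nf ↔ t.Nf := by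
  induction t with
  | var n => intro ρ; rfl
  | lam A u ih | efq i u ih => intro ρ; exact ih
  | app t u iht ihu => intro ρ; simp only [rename, Nf, iht, ihu, forall_rename_ne_lam]
  | pair t u iht ihu => intro ρ; simp only [rename, Nf, iht, ihu]
  | proj i u ih => intro ρ; simp only [rename, Nf, ih, forall_rename_ne_pair]
  | par A B u v _ _ => intro ρ; rfl

theorem Nf.parFree {t : Tm} (h : t.Nf) : t.ParFree := by
  induction t with
  | var n => trivial
  | lam A u ih | efq i u ih => exact ih h
  | app t u iht ihu => exact ⟨iht h.1, ihu h.2.1⟩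
  | pair t u iht ihu => exact ⟨iht h.1, ihu h.2⟩
  | proj i u ih => exact ih h.1
  | par A B u v _ _ => exact h

theorem Nf.intNormal {t : Tm} (h : t.Nf) : IntNormal t := by
  intro t' hs
  generalize [] = Γ at hs
  induction hs with
  | base hb =>
    cases hb with
    | beta A u s => exact h.2.2 _ _ rfl
    | proj₀ | proj₁ => exact h.2 _ _ rfl
  | lam _ ih | efq _ ih => exact ih h
  | appL _ ih | pairL _ ih | proj _ ih => exact ih h.1
  | appR _ ih => exact ih h.2.1
  | pairR _ ih => exact ih h.2
  | parL _ _ | parR _ _ => exact h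

end Tm

/-! ### Weak normalization of simply typed terms -/

/-- The term has an intuitionistic normal form. -/
def WN (t : Tm) : Prop := ∃ t', ISteps t t' ∧ t'.Nf

/-- Reducible terms of a given type. -/
def Red : Form → Tm → Prop
  | .bot, t => WN t
  | .atom _, t => WN t
  | .and A B, t => WN t ∧ Red A (.proj false t) ∧ Red B (.proj true t)
  | .imp A B, t => WN t ∧ ∀ (ρ : ℕ → ℕ) (u : Tm), Red A u → Red B (.app (t.rename ρ) u)

theorem WN.rename {t : Tm} (h : WN t) (ρ : ℕ → ℕ) : WN (t.rename ρ) :=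
  let ⟨_, h₁, h₂⟩ := h
  ⟨_, h₁.rename ρ, Tm.nf_rename.2 h₂⟩

theorem Red.wn : ∀ {A : Form} {t : Tm}, Red A t → WN t
  | .bot, _, h => h
  | .atom _, _, h => h
  | .and _ _, _, h => h.1
  | .imp _ _, _, h => h.1

theorem Red.expand : ∀ {A : Form} {t t' : Tm}, ISteps t t' → Red A t' → Red A t
  | .bot, _, _, h, ⟨s, h₁, h₂⟩ => ⟨s, h.trans h₁, h₂⟩
  | .atom _, _, _, h, ⟨s, h₁, h₂⟩ => ⟨s, h.trans h₁, h₂⟩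
  | .and _ _, _, _, h, ⟨⟨s, h₁, h₂⟩, hA, hB⟩ =>
    ⟨⟨s, h.trans h₁, h₂⟩, hA.expand h.proj, hB.expand h.proj⟩
  | .imp _ _, _, _, h, ⟨⟨s, h₁, h₂⟩, hB⟩ =>
    ⟨⟨s, h.trans h₁, h₂⟩, fun ρ u hu => (hB ρ u hu).expand ((h.rename ρ).app .refl)⟩

theorem Red.rename : ∀ {A : Form} {t : Tm}, Red A t → ∀ ρ : ℕ → ℕ, Red A (t.rename ρ)
  | .bot, _, h, ρ => WN.rename h ρ
  | .atom _, _, h, ρ => WN.rename h ρ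
  | .and _ _, _, ⟨h, hA, hB⟩, ρ => ⟨h.rename ρ, hA.rename ρ, hB.rename ρ⟩
  | .imp _ _, _, ⟨h, hB⟩, ρ => ⟨h.rename ρ, fun ρ' u hu => by
      rw [Tm.rename_rename]; exact hB _ u hu⟩

/-- Projecting a neutral normal term, or applying it to a normal argument, gives again a neutral
normal term. A reducible argument is first brought to normal form, and reducibility is carried back
by `Red.expand`. -/
theorem red_of_neutral : ∀ {A : Form} {t : Tm}, t.Nf → t.Neutral → Red A t
  | .bot, t, h, _ => ⟨t, .refl, h⟩
  | .atom _, t, h, _ => ⟨t, .refl, h⟩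
  | .and _ _, t, h, hn => ⟨⟨t, .refl, h⟩, red_of_neutral ⟨h, hn.2⟩ (Tm.neutral_proj _ _),
      red_of_neutral ⟨h, hn.2⟩ (Tm.neutral_proj _ _)⟩
  | .imp _ _, t, h, hn => ⟨⟨t, .refl, h⟩, fun ρ u hu => by
      obtain ⟨u', h₁, h₂⟩ := hu.wn
      have : Tm.Nf (.app (t.rename ρ) u') :=
        ⟨Tm.nf_rename.2 h, h₂, Tm.forall_rename_ne_lam.2 hn.1⟩
      exact (red_of_neutral this (Tm.neutral_app _ _)).expand (.app .refl h₁)⟩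

/-- Tait's reducibility argument. Since only weak normalization is needed, closure under expansion
suffices; the quantification over renamings in the clause for `→` allows the substituted terms to be
moved under binders. -/
theorem HasType.red {Γ : List Form} {t : Tm} {A : Form} (h : HasType Γ t A) :
    t.ParFree → ∀ {σ : ℕ → Tm}, (∀ n F, Γ[n]? = some F → Red F (σ n)) → Red A (t.subst σ) := by
  induction h with
  | var e => intro _ σ hσ; exact hσ _ _ e
  | @lam Γ A B u hu ih =>
    intro hp σ hσ
    constructor
    -- The bound variable itself is neutral and normal, hence reducible, so the induction hypothesis
    -- normalizes the open body.
    · obtain ⟨u', h₁, h₂⟩ := (ih hp (σ := Tm.liftSub σ) fun n F e => by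
        cases n with
        | zero => exact red_of_neutral trivial (Tm.neutral_var 0)
        | succ n => exact (hσ n F (by simpa using e)).rename _).wn
      exact ⟨.lam A u', h₁.lam, h₂⟩
    · intro ρ w hw
      refine Red.expand (.single (Compat.base (.beta _ _ _))) ?_
      rw [Tm.inst_subst_liftSub]
      refine ih hp fun n F e => ?_
      cases n with
      | zero => simp at e; subst e; exact hw
      | succ n => exact (hσ n F (by simpa using e)).rename _
  | app _ _ iht ihu =>
    intro hp σ hσ
    have := (iht hp.1 hσ).2 id _ (ihu hp.2 hσ)
    rwa [Tm.rename_id] at this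
  | pair _ _ ihu iht =>
    intro hp σ hσ
    have hu := ihu hp.1 hσ
    have ht := iht hp.2 hσ
    obtain ⟨u', hu₁, hu₂⟩ := hu.wn
    obtain ⟨t', ht₁, ht₂⟩ := ht.wn
    exact ⟨⟨_, hu₁.pair ht₁, hu₂, ht₂⟩, hu.expand (.single (Compat.base (.proj₀ _ _))),
      ht.expand (.single (Compat.base (.proj₁ _ _)))⟩
  | proj₀ _ ih => intro hp σ hσ; exact (ih hp hσ).2.1
  | proj₁ _ ih => intro hp σ hσ; exact (ih hp hσ).2.2
  | efq _ ih =>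
    intro hp σ hσ
    obtain ⟨u', h₁, h₂⟩ := (ih hp hσ).wn
    exact ⟨_, h₁.efq, h₂⟩
  | par _ _ _ _ => exact fun h => h.elim

theorem HasType.wn {Γ : List Form} {t : Tm} {A : Form} (h : HasType Γ t A) (hp : t.ParFree) :
    WN t := by
  have := h.red hp (σ := Tm.var) fun n F _ => red_of_neutral trivial (Tm.neutral_var n)
  rw [Tm.subst_var] at this
  exact this.wn

/-! ### Subformulas -/

namespace Form

theorem mem_subformulas_self (A : Form) : A ∈ A.subformulas := by
  cases A <;> simp [subformulas]

theorem subformulas_trans {A B C : Form} (h : A ∈ B.subformulas) (h' : B ∈ C.subformulas) :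
    A ∈ C.subformulas := by
  induction C with
  | bot | atom n => simp [subformulas] at h'; subst h'; exact h
  | and C D ihC ihD | imp C D ihC ihD =>
    simp only [subformulas, Finset.mem_insert, Finset.mem_union] at h'
    rcases h' with rfl | h' | h'
    · exact h
    · simp [subformulas, ihC h']
    · simp [subformulas, ihD h']

theorem symbols_le {A B : Form} (h : A ∈ B.subformulas) : A = B ∨ A.symbols < B.symbols := by
  induction B with
  | bot | atom n => simp [subformulas] at h; exact .inl h
  | and C D ihC ihD | imp C D ihC ihD =>
    simp only [subformulas, Finset.mem_insert, Finset.mem_union] at h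
    rcases h with rfl | h | h
    · exact .inl rfl
    · right; rcases ihC h with rfl | h <;> simp only [symbols] <;> omega
    · right; rcases ihD h with rfl | h <;> simp only [symbols] <;> omega

theorem ProperSubformula.symbols_lt {A B : Form} (h : ProperSubformula A B) :
    A.symbols < B.symbols :=
  (symbols_le h.1).resolve_left h.2

theorem properSubformula_of_mem {P A B : Form} (h : P ∈ A.subformulas)
    (h' : ProperSubformula A B) : ProperSubformula P B := by
  refine ⟨subformulas_trans h h'.1, ?_⟩
  rintro rfl
  have := h'.symbols_lt
  rcases symbols_le h with h | h
  · exact h'.2 h.symm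
  · omega

theorem ProperSubformula.trans_mem {P A B : Form} (h : ProperSubformula P A)
    (h' : A ∈ B.subformulas) : ProperSubformula P B := by
  by_cases e : A = B
  · exact e ▸ h
  · exact properSubformula_of_mem h.1 ⟨h', e⟩

theorem properSubformula_imp {P A B : Form} :
    ProperSubformula P (imp A B) ↔ P ∈ A.subformulas ∨ P ∈ B.subformulas := by
  constructor
  · rintro ⟨h, h'⟩; simpa [subformulas, h'] using h
  · intro h
    refine ⟨by simp [subformulas, h], ?_⟩
    rintro rfl
    rcases h with h | h <;> rcases symbols_le h with h | h
    · have := congrArg symbols h; simp only [symbols] at this; omega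
    · simp only [symbols] at h; omega
    · have := congrArg symbols h; simp only [symbols] at this; omega
    · simp only [symbols] at h; omega

theorem StrongSubformula.trans_mem {P A B : Form} (h : StrongSubformula P A)
    (h' : A ∈ B.subformulas) : StrongSubformula P B :=
  let ⟨Q, h₁, h₂, h₃⟩ := h
  ⟨Q, h₁, h₂.trans_mem h', h₃⟩

theorem strongSubformula_of_mem {P Q A : Form} (h : P ∈ Q.subformulas)
    (h' : StrongSubformula Q A) : StrongSubformula P A :=
  let ⟨R, h₁, h₂, h₃⟩ := h'
  ⟨R, h₁, h₂, properSubformula_of_mem h h₃⟩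

theorem StrongSubformula.properSubformula {P A : Form} (h : StrongSubformula P A) :
    ProperSubformula P A :=
  let ⟨_, _, h₂, h₃⟩ := h
  properSubformula_of_mem h₃.1 h₂

theorem mem_subformulas_of_mem_primeFactors {P A : Form} (h : P ∈ A.primeFactors) :
    P ∈ A.subformulas := by
  induction A with
  | bot | atom n | imp B C _ _ =>
    simp only [primeFactors, Finset.mem_singleton] at h; subst h; exact mem_subformulas_self _
  | and B C ihB ihC =>
    simp only [primeFactors, Finset.mem_union] at h
    simp only [subformulas, Finset.mem_insert, Finset.mem_union]
    exact .inr (h.imp ihB ihC)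

theorem isPrime_of_mem_primeFactors {P A : Form} (h : P ∈ A.primeFactors) : P.IsPrime := by
  induction A with
  | bot | atom n | imp B C _ _ =>
    simp only [primeFactors, Finset.mem_singleton] at h; subst h; intro _ _ h; cases h
  | and B C ihB ihC =>
    simp only [primeFactors, Finset.mem_union] at h
    exact h.elim ihB ihC

/-- Only conjunctions lie above the prime factors in the formula tree, so a prime subformula must be
inside one of the factors. -/
theorem exists_primeFactor {Q A : Form} (h : Q ∈ A.subformulas) (hQ : Q.IsPrime) :
    ∃ R ∈ A.primeFactors, Q ∈ R.subformulas := by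
  induction A with
  | bot | atom n | imp B C _ _ => exact ⟨_, by simp [primeFactors], h⟩
  | and B C ihB ihC =>
    simp only [subformulas, Finset.mem_insert, Finset.mem_union] at h
    simp only [primeFactors, Finset.mem_union]
    rcases h with rfl | h | h
    · exact absurd rfl (hQ B C)
    · obtain ⟨R, h₁, h₂⟩ := ihB h; exact ⟨R, .inl h₁, h₂⟩
    · obtain ⟨R, h₁, h₂⟩ := ihC h; exact ⟨R, .inr h₁, h₂⟩

/-- The empty list has to be excluded: its conjunction is `⊤`, which is a prime factor of itself and
comes from no member. -/
theorem mem_primeFactors_conj {P : Form} : ∀ {L : List Form}, L ≠ [] →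
    P ∈ (conj L).primeFactors → ∃ A ∈ L, P ∈ A.primeFactors
  | [A], _, h => ⟨A, by simp, h⟩
  | A :: B :: l, _, h => by
    simp only [conj, primeFactors, Finset.mem_union] at h
    rcases h with h | h
    · exact ⟨A, by simp, h⟩
    · obtain ⟨C, h₁, h₂⟩ := mem_primeFactors_conj (L := B :: l) (by simp) h
      exact ⟨C, by simp [List.mem_cons.1 h₁], h₂⟩

/-- The set of formulas contains the subformulas of its members. -/
def SubClosed (S : Form → Prop) : Prop := ∀ ⦃P Q⦄, S Q → P ∈ Q.subformulas → S P

/-- The strong subformulas of `A` belong to `S`. -/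
def StrongIn (S : Form → Prop) (A : Form) : Prop := ∀ P, StrongSubformula P A → S P

/-- The proper subformulas of the prime factors of `A` belong to `S`. -/
def FactorIn (S : Form → Prop) (A : Form) : Prop :=
  ∀ Q ∈ A.primeFactors, ∀ P, ProperSubformula P Q → S P

/-- The prime factors of `A` belong to `S`. -/
def LowIn (S : Form → Prop) (A : Form) : Prop := ∀ P ∈ A.primeFactors, S P

variable {S : Form → Prop} {A B : Form}

theorem StrongIn.of_and (h : StrongIn S (and A B)) : StrongIn S A ∧ StrongIn S B :=
  ⟨fun P hP => h P (hP.trans_mem (by simp [subformulas, mem_subformulas_self])),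
    fun P hP => h P (hP.trans_mem (by simp [subformulas, mem_subformulas_self]))⟩

/-- A prime factor of `A` is a prime proper subformula of `A → B`, so its proper subformulas are
strong subformulas of `A → B`. Hence the condition `StrongIn` on a function yields `FactorIn` for
its arguments. -/
theorem StrongIn.of_imp (h : StrongIn S (imp A B)) : FactorIn S A ∧ StrongIn S B :=
  ⟨fun Q hQ P hP => h P ⟨Q, isPrime_of_mem_primeFactors hQ,
      properSubformula_imp.2 (.inl (mem_subformulas_of_mem_primeFactors hQ)), hP⟩,
    fun P hP => h P (hP.trans_mem (by simp [subformulas, mem_subformulas_self]))⟩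

theorem strongIn_imp (hA : FactorIn S A) (hB : FactorIn S B) : StrongIn S (imp A B) := by
  rintro P ⟨Q, hQ, hQ', hP⟩
  rcases properSubformula_imp.1 hQ' with h | h
  · obtain ⟨R, hR, hR'⟩ := exists_primeFactor h hQ
    exact hA R hR P (hP.trans_mem hR')
  · obtain ⟨R, hR, hR'⟩ := exists_primeFactor h hQ
    exact hB R hR P (hP.trans_mem hR')

theorem strongIn_atom (n : ℕ) : StrongIn S (atom n) := by
  rintro P ⟨Q, -, ⟨h, h'⟩, -⟩
  simp [subformulas, h'] at h

theorem factorIn_bot : FactorIn S bot := by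
  rintro Q h P ⟨h', h''⟩
  simp only [primeFactors, Finset.mem_singleton] at h
  subst h
  simp [subformulas, h''] at h'

theorem FactorIn.of_and (h : FactorIn S (and A B)) : FactorIn S A ∧ FactorIn S B :=
  ⟨fun Q hQ => h Q (by simp [primeFactors, hQ]), fun Q hQ => h Q (by simp [primeFactors, hQ])⟩

theorem FactorIn.of_imp (h : FactorIn S (imp A B)) : S A ∧ S B :=
  ⟨h (imp A B) (by simp [primeFactors]) _ (properSubformula_imp.2 (.inl (mem_subformulas_self A))),
    h (imp A B) (by simp [primeFactors]) _ (properSubformula_imp.2 (.inr (mem_subformulas_self B)))⟩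

theorem factorIn_of_properSubformula (h : ∀ P, ProperSubformula P A → S P) : FactorIn S A :=
  fun _ hQ P hP => h P (hP.trans_mem (mem_subformulas_of_mem_primeFactors hQ))

theorem SubClosed.strongIn (hS : SubClosed S) (h : S A) : StrongIn S A :=
  fun _ hP => hS h hP.properSubformula.1

theorem SubClosed.lowIn (hS : SubClosed S) (h : S A) : LowIn S A :=
  fun _ hP => hS h (mem_subformulas_of_mem_primeFactors hP)

theorem SubClosed.factorIn (hS : SubClosed S) (h : LowIn S A) : FactorIn S A :=
  fun Q hQ _ hP => hS (h Q hQ) hP.1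

end Form

/-! ### The subformula property of normal simply typed terms -/

/-- The strong subformulas of the types of the free variables of `t` belong to `S`. -/
def FreeStrongIn (S : Form → Prop) (Γ : List Form) (t : Tm) : Prop :=
  ∀ n F, t.occurs n = true → Γ[n]? = some F → F.StrongIn S

theorem FreeStrongIn.cons {S : Form → Prop} {Γ : List Form} {A : Form} {t u : Tm}
    (h : FreeStrongIn S Γ t) (hu : ∀ n, u.occurs (n + 1) = true → t.occurs n = true)
    (hA : u.occurs 0 = true → A.StrongIn S) : FreeStrongIn S (A :: Γ) u := by
  intro n F hn e
  cases n with
  | zero => simp at e; subst e; exact hA hn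
  | succ n => exact h n F (hu n hn) (by simpa using e)

theorem FreeStrongIn.mono {S : Form → Prop} {Γ : List Form} {t u : Tm}
    (h : FreeStrongIn S Γ t) (hu : ∀ n, u.occurs n = true → t.occurs n = true) :
    FreeStrongIn S Γ u :=
  fun n F hn e => h n F (hu n hn) e

namespace Tm

/-- The types of the λ-variables bound in the term belong to `S`. -/
def BindersIn (S : Form → Prop) : Tm → Prop
  | var _ => True
  | lam A u => S A ∧ BindersIn S u
  | app t u => BindersIn S t ∧ BindersIn S u
  | pair u t => BindersIn S u ∧ BindersIn S t
  | proj _ u => BindersIn S u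
  | efq _ u => BindersIn S u
  | par _ _ u v => BindersIn S u ∧ BindersIn S v

/-- Each occurrence of the variable `n` is applied to an argument. -/
def Applied : ℕ → Tm → Prop
  | n, var m => m ≠ n
  | n, lam _ u => Applied (n + 1) u
  | n, app t u => (t = var n ∨ Applied n t) ∧ Applied n u
  | n, pair u t => Applied n u ∧ Applied n t
  | n, proj _ u => Applied n u
  | n, efq _ u => Applied n u
  | n, par _ _ u v => Applied (n + 1) u ∧ Applied (n + 1) v

end Tm

/-- Along a neutral normal term the type only descends from that of its head variable, or it is an
atom produced by ex falso, which has no strong subformulas; so `StrongIn` is inherited, and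
arguments receive types satisfying `FactorIn`. For an introduction, `FactorIn` of the type is
assumed and passes to the parts: for `A → B` it puts `A` and `B` into `S`, which takes care of the
bound variable. The alternative `t = .var n` is kept open because in head position only `StrongIn`
is known of the type. -/
theorem Tm.Nf.subformula {S : Form → Prop} (hS : Form.SubClosed S) {Γ : List Form} {t : Tm}
    {A : Form} (h : HasType Γ t A) : t.Nf → FreeStrongIn S Γ t →
      (t.Neutral → A.StrongIn S) ∧ (t.Neutral ∨ A.FactorIn S →
        t.BindersIn S ∧ ∀ n D E, Γ[n]? = some (.imp D E) → ¬ (S D ∧ S E) →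
          t = .var n ∨ t.Applied n) := by
  -- In a position whose type satisfies `FactorIn`, a bare variable of type `D → E` would put both
  -- `D` and `E` into `S`.
  have goal : ∀ {Γ : List Form} {t : Tm} {A : Form} {n : ℕ} {D E : Form}, HasType Γ t A →
      A.FactorIn S → Γ[n]? = some (.imp D E) → ¬ (S D ∧ S E) → t = .var n ∨ t.Applied n →
      t.Applied n := by
    intro Γ t A n D E ht hA e hDE h
    refine h.resolve_left ?_
    rintro rfl
    cases ht with
    | var e' =>
    rw [e] at e'
    cases e'
    exact hDE hA.of_imp
  induction h with
  | @var Γ m A e =>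
    intro _ hf
    refine ⟨fun _ => hf m A (by simp [Tm.occurs]) e, fun _ => ⟨trivial, fun n D E _ _ => ?_⟩⟩
    by_cases h : m = n
    · exact .inl (h ▸ rfl)
    · exact .inr h
  | @lam Γ A B u hu ih =>
    intro hn hf
    refine ⟨fun h => absurd rfl (h.1 _ _), fun h => ?_⟩
    have h := h.resolve_left fun h => h.1 _ _ rfl
    obtain ⟨hA, hB⟩ := h.of_imp
    have hB := hS.factorIn (hS.lowIn hB)
    obtain ⟨h₁, h₂⟩ := (ih hn (hf.cons (fun n h => h) fun _ => hS.strongIn hA)).2 (.inr hB)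
    refine ⟨⟨hA, h₁⟩, fun n D E e hDE => .inr ?_⟩
    have e : (A :: Γ)[n + 1]? = some (.imp D E) := by simpa using e
    have := goal hu hB e hDE (h₂ (n + 1) D E e hDE)
    exact this
  | @app Γ A B t u ht hu iht ihu =>
    intro hn hf
    have hne : t.Neutral := ⟨hn.2.2, by rintro s s' rfl; cases ht⟩
    obtain ⟨h₁, h₂⟩ := iht hn.1 (hf.mono fun n h => by simp [Tm.occurs, h])
    obtain ⟨hA, hB⟩ := (h₁ hne).of_imp
    obtain ⟨h₃, h₄⟩ := h₂ (.inl hne)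
    obtain ⟨h₅, h₆⟩ := (ihu hn.2.1 (hf.mono fun n h => by simp [Tm.occurs, h])).2 (.inr hA)
    exact ⟨fun _ => hB, fun _ => ⟨⟨h₃, h₅⟩, fun n D E e hDE => .inr
      ⟨h₄ n D E e hDE, goal hu hA e hDE (h₆ n D E e hDE)⟩⟩⟩
  | @pair Γ A B u t hu ht ihu iht =>
    intro hn hf
    refine ⟨fun h => absurd rfl (h.2 _ _), fun h => ?_⟩
    obtain ⟨hA, hB⟩ := (h.resolve_left fun h => h.2 _ _ rfl).of_and
    obtain ⟨h₃, h₄⟩ := (ihu hn.1 (hf.mono fun n h => by simp [Tm.occurs, h])).2 (.inr hA)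
    obtain ⟨h₅, h₆⟩ := (iht hn.2 (hf.mono fun n h => by simp [Tm.occurs, h])).2 (.inr hB)
    exact ⟨⟨h₃, h₅⟩, fun n D E e hDE => .inr
      ⟨goal hu hA e hDE (h₄ n D E e hDE), goal ht hB e hDE (h₆ n D E e hDE)⟩⟩
  | @proj₀ Γ A B u hu ih =>
    intro hn hf
    have hne : u.Neutral := ⟨(by rintro C s rfl; cases hu), hn.2⟩
    obtain ⟨h₁, h₂⟩ := ih hn.1 hf
    refine ⟨fun _ => (h₁ hne).of_and.1, fun _ => ⟨(h₂ (.inl hne)).1, fun n D E e hDE => .inr ?_⟩⟩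
    refine ((h₂ (.inl hne)).2 n D E e hDE).resolve_left ?_
    rintro rfl
    cases hu with | var e' => rw [e] at e'; cases e'
  | @proj₁ Γ A B u hu ih =>
    intro hn hf
    have hne : u.Neutral := ⟨(by rintro C s rfl; cases hu), hn.2⟩
    obtain ⟨h₁, h₂⟩ := ih hn.1 hf
    refine ⟨fun _ => (h₁ hne).of_and.2, fun _ => ⟨(h₂ (.inl hne)).1, fun n D E e hDE => .inr ?_⟩⟩
    refine ((h₂ (.inl hne)).2 n D E e hDE).resolve_left ?_
    rintro rfl
    cases hu with | var e' => rw [e] at e'; cases e'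
  | @efq Γ P u hu ih =>
    intro hn hf
    obtain ⟨h₁, h₂⟩ := (ih hn hf).2 (.inr Form.factorIn_bot)
    exact ⟨fun _ => Form.strongIn_atom P, fun _ => ⟨h₁, fun n D E e hDE => by
      have := goal hu Form.factorIn_bot e hDE (h₂ n D E e hDE)
      exact .inr this⟩⟩
  | par _ _ _ _ => exact fun h => h.elim

theorem Tm.Nf.bindersIn {S : Form → Prop} (hS : Form.SubClosed S) {Γ : List Form} {t : Tm}
    {A : Form} (h : HasType Γ t A) (hn : t.Nf) (hf : FreeStrongIn S Γ t) (hA : A.FactorIn S) :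
    t.BindersIn S :=
  ((hn.subformula hS h hf).2 (.inr hA)).1

theorem Tm.Nf.applied {S : Form → Prop} (hS : Form.SubClosed S) {Γ : List Form} {t : Tm}
    {A : Form} (h : HasType Γ t A) (hn : t.Nf) (hf : FreeStrongIn S Γ t) (hA : A.FactorIn S)
    {n : ℕ} {D E : Form} (e : Γ[n]? = some (.imp D E)) (hDE : ¬ (S D ∧ S E)) : t.Applied n := by
  refine (((hn.subformula hS h hf).2 (.inr hA)).2 n D E e hDE).resolve_left ?_
  rintro rfl
  cases h with | var e' => rw [e] at e'; cases e'; exact hDE hA.of_imp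

theorem Tm.exists_fill {t : Tm} : ∀ {n : ℕ}, t.ParFree → t.Applied n → t.occurs n = true →
    ∃ (𝒞 : Ctx) (u : Tm), t = 𝒞.fill (.app (.var (n + 𝒞.depth)) u) ∧
      𝒞.occursRight n = false ∧ u.occurs (n + 𝒞.depth) = false := by
  induction t with
  | var m => intro n _ h h'; exact absurd (Tm.occurs_var.1 h').symm h
  | lam A u ih =>
    intro n hp h h'
    obtain ⟨𝒞, s, h₁, h₂, h₃⟩ := ih hp h h'
    have e : n + 1 + 𝒞.depth = n + (Ctx.lam A 𝒞).depth := by rw [Ctx.depth_lam]; ring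
    rw [e] at h₁ h₃
    exact ⟨.lam A 𝒞, s, congrArg _ h₁, h₂, h₃⟩
  | app t u iht ihu =>
    intro n hp h h'
    -- The right-hand subterm is searched before the left-hand one, so the occurrence found is the
    -- rightmost.
    by_cases hu : u.occurs n = true
    · obtain ⟨𝒞, s, h₁, h₂, h₃⟩ := ihu hp.2 h.2 hu
      exact ⟨.appR t 𝒞, s, congrArg _ h₁, h₂, h₃⟩
    · rcases h.1 with rfl | ht
      · exact ⟨.hole, u, rfl, rfl, by simpa [Ctx.depth, Ctx.binders] using hu⟩
      · obtain ⟨𝒞, s, h₁, h₂, h₃⟩ := iht hp.1 ht (by simpa [Tm.occurs, hu] using h')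
        exact ⟨.appL 𝒞 u, s, congrArg (Tm.app · u) h₁, by simp [Ctx.occursRight, h₂, hu], h₃⟩
  | pair t u iht ihu =>
    intro n hp h h'
    by_cases hu : u.occurs n = true
    · obtain ⟨𝒞, s, h₁, h₂, h₃⟩ := ihu hp.2 h.2 hu
      exact ⟨.pairR t 𝒞, s, congrArg _ h₁, h₂, h₃⟩
    · obtain ⟨𝒞, s, h₁, h₂, h₃⟩ := iht hp.1 h.1 (by simpa [Tm.occurs, hu] using h')
      exact ⟨.pairL 𝒞 u, s, congrArg (Tm.pair · u) h₁, by simp [Ctx.occursRight, h₂, hu], h₃⟩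
  | proj i u ih =>
    intro n hp h h'
    obtain ⟨𝒞, s, h₁, h₂, h₃⟩ := ih hp h h'
    exact ⟨.proj i 𝒞, s, congrArg _ h₁, h₂, h₃⟩
  | efq P u ih =>
    intro n hp h h'
    obtain ⟨𝒞, s, h₁, h₂, h₃⟩ := ih hp h h'
    exact ⟨.efq P 𝒞, s, congrArg _ h₁, h₂, h₃⟩
  | par _ _ _ _ _ _ => exact fun h => h.elim

theorem Tm.exists_fillComm {t : Tm} (hp : t.ParFree) (ha : t.Applied 0)
    (ho : t.occurs 0 = true) : ∃ (𝒞 : Ctx) (u : Tm), t = 𝒞.fillComm u ∧ 𝒞.Rightmost u := by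
  obtain ⟨𝒞, u, h₁, h₂, h₃⟩ := t.exists_fill hp ha ho
  rw [zero_add] at h₁ h₃
  exact ⟨𝒞, u, h₁, h₂, h₃⟩

namespace Ctx

theorem forall_binders {S : Form → Prop} {s : Tm} : ∀ {𝒞 : Ctx}, (𝒞.fill s).BindersIn S →
    ∀ A ∈ 𝒞.binders, S A
  | hole, _ => by simp [binders]
  | lam B 𝒞, h => by
    intro A hA
    simp only [binders, List.mem_append, List.mem_singleton] at hA
    rcases hA with hA | rfl
    · exact forall_binders h.2 A hA
    · exact h.1
  | appL 𝒞 _, h => forall_binders (𝒞 := 𝒞) h.1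
  | appR _ 𝒞, h => forall_binders (𝒞 := 𝒞) h.2
  | pairL 𝒞 _, h => forall_binders (𝒞 := 𝒞) h.1
  | pairR _ 𝒞, h => forall_binders (𝒞 := 𝒞) h.2
  | proj _ 𝒞, h => forall_binders (𝒞 := 𝒞) h
  | efq _ 𝒞, h => forall_binders (𝒞 := 𝒞) h

theorem parFree_fill {e s : Tm} (hs : s.ParFree) : ∀ {𝒞 : Ctx}, (𝒞.fill e).ParFree →
    (𝒞.fill s).ParFree
  | hole, _ => hs
  | lam _ 𝒞, h => parFree_fill hs (𝒞 := 𝒞) h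
  | appL 𝒞 _, h => ⟨parFree_fill hs (𝒞 := 𝒞) h.1, h.2⟩
  | appR _ 𝒞, h => ⟨h.1, parFree_fill hs (𝒞 := 𝒞) h.2⟩
  | pairL 𝒞 _, h => ⟨parFree_fill hs (𝒞 := 𝒞) h.1, h.2⟩
  | pairR _ 𝒞, h => ⟨h.1, parFree_fill hs (𝒞 := 𝒞) h.2⟩
  | proj _ 𝒞, h => parFree_fill hs (𝒞 := 𝒞) h
  | efq _ 𝒞, h => parFree_fill hs (𝒞 := 𝒞) h

theorem parFree_of_fill {e : Tm} : ∀ {𝒞 : Ctx}, (𝒞.fill e).ParFree → e.ParFree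
  | hole, h => h
  | lam _ 𝒞, h => parFree_of_fill (𝒞 := 𝒞) h
  | appL 𝒞 _, h => parFree_of_fill (𝒞 := 𝒞) h.1
  | appR _ 𝒞, h => parFree_of_fill (𝒞 := 𝒞) h.2
  | pairL 𝒞 _, h => parFree_of_fill (𝒞 := 𝒞) h.1
  | pairR _ 𝒞, h => parFree_of_fill (𝒞 := 𝒞) h.2
  | proj _ 𝒞, h => parFree_of_fill (𝒞 := 𝒞) h
  | efq _ 𝒞, h => parFree_of_fill (𝒞 := 𝒞) h

theorem occursRight_rename {𝒞 : Ctx} : ∀ {ρ : ℕ → ℕ} {n : ℕ},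
    (∀ m, ρ m = ρ n → m = n) → 𝒞.occursRight n = false →
      (𝒞.rename ρ).occursRight (ρ n) = false := by
  have tm : ∀ {t : Tm} {ρ : ℕ → ℕ} {n : ℕ}, (∀ m, ρ m = ρ n → m = n) → t.occurs n = false →
      (t.rename ρ).occurs (ρ n) = false := by
    intro t ρ n hρ h
    rw [← Bool.not_eq_true, Tm.occurs_rename]
    rintro ⟨m, hm, e⟩
    rw [hρ m e, h] at hm
    cases hm
  induction 𝒞 with
  | hole => intro ρ n _ _; rfl
  | lam A 𝒞 ih =>
    intro ρ n hρ h
    refine ih (ρ := liftRen ρ) (n := n + 1) (fun m e => ?_) h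
    cases m with
    | zero => cases e
    | succ m => simp only [liftRen, Nat.add_right_cancel_iff] at e; rw [hρ m e]
  | appL 𝒞 t ih | pairL 𝒞 t ih =>
    intro ρ n hρ h
    simp only [occursRight, Bool.or_eq_false_iff] at h
    simp only [rename, occursRight, Bool.or_eq_false_iff]
    exact ⟨ih hρ h.1, tm hρ h.2⟩
  | appR t 𝒞 ih | pairR t 𝒞 ih | proj i 𝒞 ih | efq i 𝒞 ih => intro ρ n hρ h; exact ih hρ h

/-- The path from the root to the hole consists of eliminations of the term in the hole. -/
def Spine : Ctx → Prop
  | hole => True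
  | appL 𝒞 _ => Spine 𝒞
  | proj _ 𝒞 => Spine 𝒞
  | _ => False

/-- Eliminations have their principal term on the left, so on a spine everything beside the hole
stands to its right. -/
theorem Spine.occurs : ∀ {𝒞 : Ctx} {n : ℕ}, 𝒞.Spine → 𝒞.occurs n = 𝒞.occursRight n
  | hole, _, _ => rfl
  | appL 𝒞 t, n, h => by rw [Ctx.occurs, occursRight, Spine.occurs (𝒞 := 𝒞) h]
  | proj _ 𝒞, _, h => Spine.occurs (𝒞 := 𝒞) h

end Ctx

/-! ### Normalization after communication -/

namespace Tm

/-- The number of free occurrences of a variable. -/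
def count : ℕ → Tm → ℕ
  | n, var m => if n = m then 1 else 0
  | n, lam _ u => count (n + 1) u
  | n, app t u => count n t + count n u
  | n, pair u t => count n u + count n t
  | n, proj _ u => count n u
  | n, efq _ u => count n u
  | n, par _ _ u v => count (n + 1) u + count (n + 1) v

theorem count_eq_zero {t : Tm} : ∀ {n : ℕ}, t.count n = 0 ↔ t.occurs n = false := by
  induction t with
  | var m => intro n; simp [count, occurs]
  | _ => intro n; simp_all [count, occurs]

theorem count_rename {t : Tm} : ∀ {ρ : ℕ → ℕ} {n : ℕ}, (∀ m, ρ m = ρ n → m = n) →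
    (t.rename ρ).count (ρ n) = t.count n := by
  have lift : ∀ {ρ : ℕ → ℕ} {n : ℕ}, (∀ m, ρ m = ρ n → m = n) →
      ∀ m, liftRen ρ m = liftRen ρ (n + 1) → m = n + 1 := by
    intro ρ n h m e
    cases m with
    | zero => cases e
    | succ m => simp only [liftRen, Nat.add_right_cancel_iff] at e; rw [h m e]
  induction t with
  | var m =>
    intro ρ n h
    by_cases e : n = m
    · subst e; simp [rename, count]
    · have : ρ n ≠ ρ m := fun e' => e (h m e'.symm).symm
      simp [rename, count, e, this]
  | lam A u ih => intro ρ n h; exact ih (ρ := liftRen ρ) (lift h)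
  | app t u iht ihu | pair t u iht ihu =>
    intro ρ n h; simp only [rename, count]; rw [iht h, ihu h]
  | proj i u ih | efq i u ih => intro ρ n h; exact ih h
  | par A B u v ihu ihv =>
    intro ρ n h
    exact congrArg₂ (· + ·) (ihu (ρ := liftRen ρ) (lift h)) (ihv (ρ := liftRen ρ) (lift h))

end Tm

/-- When the rightmost occurrence of a variable `n` in a normal term, together with its argument,
is replaced by a term without `n`, the normal form has fewer occurrences of `n`. -/
theorem Ctx.exists_nf_count_lt {e s : Tm} (hs : s.ParFree) : ∀ {𝒞 : Ctx} {n : ℕ} {Γ : List Form}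
    {A : Form}, HasType Γ (𝒞.fill s) A → (𝒞.fill e).Nf → 𝒞.occursRight n = false →
      s.occurs (n + 𝒞.depth) = false → e.occurs (n + 𝒞.depth) = true →
      ∃ w, ISteps (𝒞.fill s) w ∧ w.Nf ∧ w.count n < (𝒞.fill e).count n ∧
        (¬ 𝒞.Spine → ((∀ B r, 𝒞.fill e ≠ .lam B r) → ∀ B r, w ≠ .lam B r) ∧
          ((∀ r r', 𝒞.fill e ≠ .pair r r') → ∀ r r', w ≠ .pair r r')) := by
  -- On a spine nothing stands to the left of the hole, and by assumption `n` does not occur to the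
  -- right of it. After the replacement `n` has vanished altogether, so whatever the normal form is,
  -- it contains no occurrence of `n`.
  have spine : ∀ {𝒞 : Ctx} {n : ℕ} {Γ : List Form} {A : Form}, 𝒞.Spine →
      HasType Γ (𝒞.fill s) A → (𝒞.fill e).Nf → 𝒞.occursRight n = false →
      s.occurs (n + 𝒞.depth) = false → e.occurs (n + 𝒞.depth) = true →
      ∃ w, ISteps (𝒞.fill s) w ∧ w.Nf ∧ w.count n < (𝒞.fill e).count n ∧
        (¬ 𝒞.Spine → ((∀ B r, 𝒞.fill e ≠ .lam B r) → ∀ B r, w ≠ .lam B r) ∧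
          ((∀ r r', 𝒞.fill e ≠ .pair r r') → ∀ r r', w ≠ .pair r r')) := by
    intro 𝒞 n Γ A hsp ht hn hr hns hne
    obtain ⟨w, hw, hw'⟩ := ht.wn (Ctx.parFree_fill hs hn.parFree)
    refine ⟨w, hw, hw', ?_, fun h => absurd hsp h⟩
    have h₁ : w.count n = 0 := by
      rw [Tm.count_eq_zero, ← Bool.not_eq_true]
      intro h
      have := (hw.steps []).occurs h
      rw [occurs_fill, hsp.occurs, hr, hns] at this
      cases this
    have h₂ : (𝒞.fill e).count n ≠ 0 := by
      rw [Ne, Tm.count_eq_zero, occurs_fill, hne]; simp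
    omega
  intro 𝒞
  induction 𝒞 with
  | hole => exact spine trivial
  | lam B 𝒞 ih =>
    intro n Γ A ht hn hr hns hne
    rw [depth_lam, show n + (𝒞.depth + 1) = n + 1 + 𝒞.depth by ring] at hns hne
    cases ht with
    | lam ht =>
    obtain ⟨w, h₁, h₂, h₃, -⟩ := ih ht hn hr hns hne
    exact ⟨.lam B w, h₁.lam, h₂, h₃, fun _ => ⟨fun h => absurd rfl (h B _), fun _ => by simp⟩⟩
  | appL 𝒞 t ih =>
    intro n Γ A ht hn hr hns hne
    -- A spine is normalized as a whole, because the replacement may turn its head into an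
    -- abstraction or a pair. If the path is not a spine, the last clause of the induction
    -- hypothesis says that the function part has not become an abstraction, so no redex arises here
    -- and `t` is not duplicated.
    by_cases hsp : 𝒞.Spine
    · exact spine (𝒞 := .appL 𝒞 t) hsp ht hn hr hns hne
    cases ht with
    | app ht _ =>
    simp only [occursRight, Bool.or_eq_false_iff] at hr
    obtain ⟨w, h₁, h₂, h₃, h₄⟩ := ih ht hn.1 hr.1 hns hne
    refine ⟨.app w t, h₁.app .refl, ⟨h₂, hn.2.1, (h₄ hsp).1 hn.2.2⟩, ?_, fun _ =>
      ⟨fun _ => by simp, fun _ => by simp⟩⟩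
    simp only [fill, Tm.count]; omega
  | appR t 𝒞 ih =>
    intro n Γ A ht hn hr hns hne
    cases ht with
    | app _ ht =>
    obtain ⟨w, h₁, h₂, h₃, -⟩ := ih ht hn.2.1 hr hns hne
    refine ⟨.app t w, .app .refl h₁, ⟨hn.1, h₂, hn.2.2⟩, ?_, fun _ =>
      ⟨fun _ => by simp, fun _ => by simp⟩⟩
    simp only [fill, Tm.count]; omega
  | pairL 𝒞 t ih =>
    intro n Γ A ht hn hr hns hne
    cases ht with
    | pair ht _ =>
    simp only [occursRight, Bool.or_eq_false_iff] at hr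
    obtain ⟨w, h₁, h₂, h₃, -⟩ := ih ht hn.1 hr.1 hns hne
    refine ⟨.pair w t, h₁.pair .refl, ⟨h₂, hn.2⟩, ?_, fun _ =>
      ⟨fun _ => by simp, fun h => absurd rfl (h _ _)⟩⟩
    simp only [fill, Tm.count]; omega
  | pairR t 𝒞 ih =>
    intro n Γ A ht hn hr hns hne
    cases ht with
    | pair _ ht =>
    obtain ⟨w, h₁, h₂, h₃, -⟩ := ih ht hn.2 hr hns hne
    refine ⟨.pair t w, .pair .refl h₁, ⟨hn.1, h₂⟩, ?_, fun _ =>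
      ⟨fun _ => by simp, fun h => absurd rfl (h _ _)⟩⟩
    simp only [fill, Tm.count]; omega
  | proj i 𝒞 ih =>
    intro n Γ A ht hn hr hns hne
    by_cases hsp : 𝒞.Spine
    · exact spine (𝒞 := .proj i 𝒞) hsp ht hn hr hns hne
    obtain ⟨B, ht⟩ : ∃ B, HasType Γ (𝒞.fill s) B := by
      cases ht with
      | proj₀ h => exact ⟨_, h⟩
      | proj₁ h => exact ⟨_, h⟩
    obtain ⟨w, h₁, h₂, h₃, h₄⟩ := ih ht hn.1 hr hns hne
    exact ⟨.proj i w, h₁.proj, ⟨h₂, (h₄ hsp).2 hn.2⟩, h₃, fun _ =>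
      ⟨fun _ => by simp, fun _ => by simp⟩⟩
  | efq P 𝒞 ih =>
    intro n Γ A ht hn hr hns hne
    cases ht with
    | efq ht =>
    obtain ⟨w, h₁, h₂, h₃, -⟩ := ih ht hn hr hns hne
    exact ⟨.efq P w, h₁.efq, h₂, h₃, fun _ => ⟨fun _ => by simp, fun _ => by simp⟩⟩

/-! ### Parallel forms -/

namespace Tm

/-- The number of parallel operators. -/
def npar : Tm → ℕ
  | var _ => 0
  | lam _ u => npar u
  | app t u => npar t + npar u
  | pair u t => npar u + npar t
  | proj _ u => npar u
  | efq _ u => npar u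
  | par _ _ u v => npar u + npar v + 1

theorem npar_rename {t : Tm} : ∀ {ρ : ℕ → ℕ}, (t.rename ρ).npar = t.npar := by
  induction t <;> intro ρ <;> simp_all [rename, npar]

theorem ParallelForm.rename {t : Tm} (h : t.ParallelForm) :
    ∀ ρ : ℕ → ℕ, (t.rename ρ).ParallelForm := by
  induction h with
  | simple h => exact fun ρ => .simple (parFree_rename.2 h)
  | par _ _ ihu ihv => exact fun ρ => .par (ihu _) (ihv _)

theorem parallelForm_rename {t : Tm} : ∀ {ρ : ℕ → ℕ},
    (t.rename ρ).ParallelForm ↔ t.ParallelForm := by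
  refine fun {ρ} => ⟨fun h => ?_, fun h => h.rename ρ⟩
  induction t generalizing ρ with
  | par A B u v ihu ihv =>
    cases h with
    | simple h => exact h.elim
    | par hu hv => exact .par (ihu hu) (ihv hv)
  | _ => cases h with | simple h => exact .simple (parFree_rename.1 h)

end Tm

/-- The map `g` records what the permutation does to the components: the exchange of two variables
when a λ crosses a parallel operator. As `g u` need not be a subterm, the induction is on the number
of operators. -/
theorem exists_parallelForm_unary {f g : Tm → Tm}
    (hf : ∀ u, u.ParFree → (f u).ParFree)
    (hg : ∀ u, u.ParallelForm → (g u).ParallelForm) (hg' : ∀ u, (g u).npar = u.npar)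
    (hstep : ∀ Γ A B u v, Step Γ (f (.par A B u v)) (.par A B (f (g u)) (f (g v)))) :
    ∀ (k : ℕ) {u : Tm}, u.ParallelForm → u.npar ≤ k → ∀ Γ : List Form,
      ∃ s, Steps Γ (f u) s ∧ s.ParallelForm := by
  intro k
  induction k with
  | zero =>
    intro u hu hk Γ
    cases hu with
    | simple hu => exact ⟨_, .refl, .simple (hf _ hu)⟩
    | par => simp [Tm.npar] at hk
  | succ k ih =>
    intro u hu hk Γ
    cases hu with
    | simple hu => exact ⟨_, .refl, .simple (hf _ hu)⟩
    | @par A B u v hu hv =>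
      simp only [Tm.npar] at hk
      obtain ⟨s, hs, hs'⟩ := ih (hg u hu) (by rw [hg']; omega) (.imp A B :: Γ)
      obtain ⟨r, hr, hr'⟩ := ih (hg v hv) (by rw [hg']; omega) (.imp B A :: Γ)
      exact ⟨_, .head (hstep Γ A B u v) (hs.par hr), .par hs' hr'⟩

theorem exists_parallelForm_binary {f : Tm → Tm → Tm}
    (hf : ∀ u w, u.ParFree → w.ParFree → (f u w).ParFree)
    (hL : ∀ Γ A B u v w, Step Γ (f (.par A B u v) w) (.par A B (f u w.shift) (f v w.shift)))
    (hR : ∀ Γ A B u v w, Step Γ (f w (.par A B u v)) (.par A B (f w.shift u) (f w.shift v))) :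
    ∀ (k : ℕ) {u w : Tm}, u.ParallelForm → w.ParallelForm → u.npar + w.npar ≤ k →
      ∀ Γ : List Form, ∃ s, Steps Γ (f u w) s ∧ s.ParallelForm := by
  have shift : ∀ w : Tm, w.shift.npar = w.npar := fun w => Tm.npar_rename
  intro k
  induction k using Nat.strong_induction_on with
  | _ k ih =>
  intro u w hu hw hk Γ
  cases hu with
  | @par A B u v hu hv =>
    simp only [Tm.npar] at hk
    obtain ⟨s, hs, hs'⟩ := ih (u.npar + w.npar) (by omega) hu (hw.rename Nat.succ)
      (by rw [← shift w]; rfl) (.imp A B :: Γ)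
    obtain ⟨r, hr, hr'⟩ := ih (v.npar + w.npar) (by omega) hv (hw.rename Nat.succ)
      (by rw [← shift w]; rfl) (.imp B A :: Γ)
    exact ⟨_, .head (hL Γ A B u v w) (hs.par hr), .par hs' hr'⟩
  | simple hu =>
    cases hw with
    | simple hw => exact ⟨_, .refl, .simple (hf _ _ hu hw)⟩
    | @par A B v v' hv hv' =>
      simp only [Tm.npar] at hk
      have hu := Tm.ParallelForm.simple hu
      obtain ⟨s, hs, hs'⟩ := ih (u.npar + v.npar) (by omega) (hu.rename Nat.succ) hv
        (by rw [← shift u]; rfl) (.imp A B :: Γ)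
      obtain ⟨r, hr, hr'⟩ := ih (u.npar + v'.npar) (by omega) (hu.rename Nat.succ) hv'
        (by rw [← shift u]; rfl) (.imp B A :: Γ)
      exact ⟨_, .head (hR Γ A B v v' u) (hs.par hr), .par hs' hr'⟩

/-- Moving a parallel operator out of any other constructor is never restricted by complexity, so
neither typing nor control of the kinds is needed. -/
theorem exists_parallelForm (t : Tm) :
    ∀ Γ : List Form, ∃ s, Steps Γ t s ∧ s.ParallelForm := by
  induction t with
  | var n => exact fun Γ => ⟨_, .refl, .simple trivial⟩
  | lam A u ih =>
    intro Γ
    obtain ⟨s, hs, hs'⟩ := ih (A :: Γ)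
    obtain ⟨r, hr, hr'⟩ := exists_parallelForm_unary (f := Tm.lam A) (g := Tm.rename swapRen)
      (fun _ h => h) (fun _ h => h.rename _) (fun _ => Tm.npar_rename)
      (fun Γ B C u v => .base (.perm (.lam Γ B C A u v))) _ hs' le_rfl Γ
    exact ⟨r, hs.lam.trans hr, hr'⟩
  | app t u iht ihu =>
    intro Γ
    obtain ⟨s, hs, hs'⟩ := iht Γ
    obtain ⟨q, hq, hq'⟩ := ihu Γ
    obtain ⟨r, hr, hr'⟩ := exists_parallelForm_binary (f := Tm.app) (fun _ _ h h' => ⟨h, h'⟩)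
      (fun Γ B C u v w => .base (.perm (.appL Γ B C u v w)))
      (fun Γ B C u v w => .base (.perm (.appR Γ B C u v w))) _ hs' hq' le_rfl Γ
    exact ⟨r, (hs.app hq).trans hr, hr'⟩
  | pair t u iht ihu =>
    intro Γ
    obtain ⟨s, hs, hs'⟩ := iht Γ
    obtain ⟨q, hq, hq'⟩ := ihu Γ
    obtain ⟨r, hr, hr'⟩ := exists_parallelForm_binary (f := Tm.pair) (fun _ _ h h' => ⟨h, h'⟩)
      (fun Γ B C u v w => .base (.perm (.pairL Γ B C u v w)))
      (fun Γ B C u v w => .base (.perm (.pairR Γ B C u v w))) _ hs' hq' le_rfl Γ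
    exact ⟨r, (hs.pair hq).trans hr, hr'⟩
  | proj i u ih =>
    intro Γ
    obtain ⟨s, hs, hs'⟩ := ih Γ
    obtain ⟨r, hr, hr'⟩ := exists_parallelForm_unary (f := Tm.proj i) (g := id)
      (fun _ h => h) (fun _ h => h) (fun _ => rfl)
      (fun Γ B C u v => .base (.perm (.proj Γ B C i u v))) _ hs' le_rfl Γ
    exact ⟨r, hs.proj.trans hr, hr'⟩
  | efq P u ih =>
    intro Γ
    obtain ⟨s, hs, hs'⟩ := ih Γ
    obtain ⟨r, hr, hr'⟩ := exists_parallelForm_unary (f := Tm.efq P) (g := id)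
      (fun _ h => h) (fun _ h => h) (fun _ => rfl)
      (fun Γ B C u v => .base (.perm (.efq Γ B C P u v))) _ hs' le_rfl Γ
    exact ⟨r, hs.efq.trans hr, hr'⟩
  | par A B u v ihu ihv =>
    intro Γ
    obtain ⟨s, hs, hs'⟩ := ihu (.imp A B :: Γ)
    obtain ⟨r, hr, hr'⟩ := ihv (.imp B A :: Γ)
    exact ⟨_, hs.par hr, .par hs' hr'⟩

/-! ### Communication kinds and complexity -/

namespace Form

theorem symbols_pos (A : Form) : 0 < A.symbols := by
  cases A <;> simp [symbols]

end Form

/-- Every formula has at least one symbol, so the maximum is positive exactly when some prime factor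
survives the filter. -/
theorem commComplexity_pos {Γ : List Form} {t : Tm} {A B C : Form} :
    0 < commComplexity Γ t A B C ↔ ∃ P, (P ∈ B.primeFactors ∨ P ∈ C.primeFactors) ∧
      ¬ P.ProperSubformula A ∧ ∀ D, IsFreeVarType Γ t D → ¬ P.StrongSubformula D := by
  rw [commComplexity, Finset.lt_sup_iff]
  simp only [Finset.mem_filter, Finset.mem_union, Form.symbols_pos, and_true]

/-- If the complexity were zero, every prime factor of the kind would be a proper subformula of `A`
or a strong subformula of the type of a free variable, and so would lie in `S`. -/
theorem posComm_of_not_lowIn {S : Form → Prop} {Γ : List Form} {A B C : Form} {u v : Tm}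
    (ht : HasType Γ (.par B C u v) A) (hA : ∀ P, Form.ProperSubformula P A → S P)
    (hf : FreeStrongIn S Γ (.par B C u v)) (h : ¬ (B.LowIn S ∧ C.LowIn S)) :
    PosComm Γ B C u v := by
  refine ⟨A, ht, commComplexity_pos.2 ?_⟩
  by_contra! hc
  have key : ∀ P, P ∈ B.primeFactors ∨ P ∈ C.primeFactors → S P := by
    intro P hP
    by_cases hPA : P.ProperSubformula A
    · exact hA P hPA
    · obtain ⟨D, ⟨n, hn, e⟩, hD⟩ := hc P hP hPA
      exact hf n D hn e P hD
  exact h ⟨fun P hP => key P (.inl hP), fun P hP => key P (.inr hP)⟩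

namespace Tm

/-- Both components of each communication kind of the term satisfy `p`. -/
def KindsIn (p : Form → Prop) : Tm → Prop
  | var _ => True
  | lam _ u => KindsIn p u
  | app t u => KindsIn p t ∧ KindsIn p u
  | pair u t => KindsIn p u ∧ KindsIn p t
  | proj _ u => KindsIn p u
  | efq _ u => KindsIn p u
  | par A B u v => (p A ∧ p B) ∧ KindsIn p u ∧ KindsIn p v

theorem kindsIn_rename {p : Form → Prop} {t : Tm} : ∀ {ρ : ℕ → ℕ},
    (t.rename ρ).KindsIn p ↔ t.KindsIn p := by
  induction t <;> intro ρ <;> simp_all [rename, KindsIn]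

theorem KindsIn.mono {p q : Form → Prop} (h : ∀ A, p A → q A) {t : Tm} (ht : t.KindsIn p) :
    t.KindsIn q := by
  induction t with
  | var n => trivial
  | lam A u ih | proj i u ih | efq i u ih => exact ih ht
  | app t u iht ihu | pair t u iht ihu => exact ⟨iht ht.1, ihu ht.2⟩
  | par A B u v ihu ihv => exact ⟨⟨h _ ht.1.1, h _ ht.1.2⟩, ihu ht.2.1, ihv ht.2.2⟩

theorem ParFree.kindsIn {p : Form → Prop} {t : Tm} (h : t.ParFree) : t.KindsIn p := by
  induction t with
  | var n => trivial
  | lam A u ih | proj i u ih | efq i u ih => exact ih h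
  | app t u iht ihu | pair t u iht ihu => exact ⟨iht h.1, ihu h.2⟩
  | par A B u v _ _ => exact h.elim

theorem exists_kindsIn_symbols_le (t : Tm) : ∃ c, t.KindsIn fun A => A.symbols ≤ c := by
  have mono : ∀ {c d : ℕ} {t : Tm}, c ≤ d → t.KindsIn (fun A => A.symbols ≤ c) →
      t.KindsIn fun A => A.symbols ≤ d := fun h => KindsIn.mono fun _ h' => h'.trans h
  induction t with
  | var n => exact ⟨0, trivial⟩
  | lam A u ih | proj i u ih | efq i u ih => exact ih
  | app t u iht ihu | pair t u iht ihu =>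
    obtain ⟨c, hc⟩ := iht
    obtain ⟨d, hd⟩ := ihu
    exact ⟨max c d, mono (le_max_left c d) hc, mono (le_max_right c d) hd⟩
  | par A B u v ihu ihv =>
    obtain ⟨c, hc⟩ := ihu
    obtain ⟨d, hd⟩ := ihv
    exact ⟨max (max c d) (max A.symbols B.symbols), ⟨by simp, by simp⟩,
      mono (by simp) hc, mono (by simp) hd⟩

theorem parFree_subst {t : Tm} : ∀ {σ : ℕ → Tm}, t.ParFree → (∀ n, (σ n).ParFree) →
    (t.subst σ).ParFree := by
  induction t with
  | var n => exact fun _ h => h n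
  | lam A u ih =>
    intro σ h hσ
    refine ih (σ := liftSub σ) h fun n => ?_
    cases n with
    | zero => trivial
    | succ n => exact parFree_rename.2 (hσ n)
  | app t u iht ihu | pair t u iht ihu => exact fun h hσ => ⟨iht h.1 hσ, ihu h.2 hσ⟩
  | proj i u ih | efq i u ih => exact fun h hσ => ih h hσ
  | par A B u v _ _ => exact fun h => h.elim

end Tm

theorem parFree_tupleVars : ∀ y : List (Form × ℕ), (tupleVars y).ParFree
  | [] => trivial
  | [_] => trivial
  | _ :: q :: l => ⟨trivial, parFree_tupleVars (q :: l)⟩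

theorem parFree_nthProj : ∀ {n i : ℕ} {t : Tm}, t.ParFree → (Tm.nthProj n i t).ParFree
  | 0, _, _, h => h
  | 1, _, _, h => h
  | _ + 2, 0, _, h => h
  | n + 2, i + 1, t, h => parFree_nthProj (n := n + 1) (i := i) (t := .proj true t) h

theorem parFree_migrate {k m : ℕ} {y z : List (Form × ℕ)} {u : Tm} (h : u.ParFree) :
    (migrate k m y z u).ParFree := by
  refine Tm.parFree_subst h fun n => ?_
  split_ifs
  · exact parFree_nthProj ⟨trivial, parFree_tupleVars z⟩
  · trivial

/-! ### Communication between normal simply typed terms -/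

theorem liftRen_succ_zero {m : ℕ} (h : liftRen Nat.succ m = liftRen Nat.succ 0) : m = 0 := by
  cases m with
  | zero => rfl
  | succ m => cases h

/-- Up to the renaming that makes room for `b`, the term arises from the normal term `𝒟[a v]` by
replacing the rightmost occurrence of `a` with its argument. The migrated `u` does not contain `a`,
since the occurrence displayed in `𝒞` was the rightmost one too; thus `Ctx.exists_nf_count_lt`
applies. -/
theorem exists_nf_fill_migrate {Γ : List Form} {A B C : Form} {𝒞 𝒟 : Ctx} {u v : Tm}
    (hC : HasType (.imp A B :: Γ) (𝒞.fillComm u) C)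
    (hD : HasType (.imp B A :: Γ) (𝒟.fillComm v) C) (hCn : (𝒞.fillComm u).Nf)
    (hDn : (𝒟.fillComm v).Nf) (hu : 𝒞.Rightmost u) (hv : 𝒟.Rightmost v) :
    ∃ w, ISteps ((𝒟.rename (liftRen Nat.succ)).fill
        (migrate 𝒞.depth 𝒟.depth (𝒞.boundVars u) (𝒟.boundVars v) u)) w ∧ w.Nf ∧
      w.count 0 < (𝒟.fillComm v).count 0 := by
  have hp : u.ParFree := (Ctx.parFree_of_fill hCn.parFree).2
  have hr := 𝒟.rename_fill (.app (.var 𝒟.depth) v) (liftRen Nat.succ)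
  obtain ⟨w, h₁, h₂, h₃, -⟩ := Ctx.exists_nf_count_lt (n := 0)
    (e := (Tm.app (.var 𝒟.depth) v).rename (liftRen^[𝒟.depth] (liftRen Nat.succ)))
    (parFree_migrate hp) (hasType_fill_migrate hC hD hu.2)
    (by rw [← hr]; exact Tm.nf_rename.2 hDn)
    (Ctx.occursRight_rename (ρ := liftRen Nat.succ) (n := 0) (fun _ => liftRen_succ_zero) hv.1)
    (by
      rw [Ctx.depth_rename, ← Bool.not_eq_true]
      intro h
      rcases occurs_migrate hu.2 h with ⟨h, -⟩ | ⟨j, h, -⟩ <;> omega)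
    (by rw [Ctx.depth_rename]; simp [Tm.rename, Tm.occurs, iterate_liftRen, liftRen])
  refine ⟨w, h₁, h₂, ?_⟩
  rw [← hr] at h₃
  have := Tm.count_rename (t := 𝒟.fillComm v) (ρ := liftRen Nat.succ) (n := 0)
    fun _ => liftRen_succ_zero
  rw [← this]
  exact h₃

/-- The new communication variable occurs in the result only if some bound variable moves. -/
theorem boundVars_ne_nil_of_occurs {𝒞 𝒟 : Ctx} {u v : Tm} (hu : u.occurs 𝒞.depth = false)
    (h : ((𝒟.rename (liftRen Nat.succ)).fill
      (migrate 𝒞.depth 𝒟.depth (𝒞.boundVars u) (𝒟.boundVars v) u)).occurs 1 = true) :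
    𝒞.boundVars u ≠ [] := by
  rw [Ctx.occurs_fill, Bool.or_eq_true, Ctx.occurs_rename, Ctx.depth_rename] at h
  rcases h with ⟨_ | m, -, e⟩ | h
  · cases e
  · simp [liftRen] at e
  · rcases occurs_migrate hu h with ⟨-, h⟩ | ⟨j, hj, -⟩
    · exact h
    · omega

theorem occurs_liftRen_succ_one (t : Tm) : (t.rename (liftRen Nat.succ)).occurs 1 = false := by
  rw [← Bool.not_eq_true, Tm.occurs_rename]
  rintro ⟨_ | m, -, e⟩
  · cases e
  · simp [liftRen] at e

/-- Nonemptiness is essential: the empty conjunction `⊤` need not belong to `S`. -/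
theorem lowIn_conjTypes_boundVars {S : Form → Prop} (hS : Form.SubClosed S) {𝒞 : Ctx} {u : Tm}
    (hne : 𝒞.boundVars u ≠ []) (h : ∀ A ∈ 𝒞.binders, S A) :
    (conjTypes (𝒞.boundVars u)).LowIn S := by
  intro P hP
  obtain ⟨A, hA, hPA⟩ := Form.mem_primeFactors_conj (by simpa using hne) hP
  obtain ⟨p, hp, rfl⟩ := List.mem_map.1 hA
  exact hS.lowIn (h _ (List.mem_of_getElem? (Ctx.mem_boundVars.1 hp).1)) P hPA

section

variable {S : Form → Prop} {C : Form}

/-- One half of the result of a cross reduction, given that compositions with fewer occurrences of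
the communication variable can be lowered. -/
theorem exists_lowIn_half {k : ℕ} {Γ : List Form} {A B : Form} {𝒞 𝒟 : Ctx} {u v : Tm}
    (ih : ∀ {Δ : List Form} {u' v' : Tm}, u'.count 0 + v'.count 0 < k →
      HasType Δ (.par B A u' v') C → u'.Nf → v'.Nf → FreeStrongIn S Δ (.par B A u' v') →
      ∃ s, Steps Δ (.par B A u' v') s ∧ s.ParallelForm ∧ s.KindsIn (Form.LowIn S))
    (hC : HasType (.imp A B :: Γ) (𝒞.fillComm u) C)
    (hD : HasType (.imp B A :: Γ) (𝒟.fillComm v) C) (hCn : (𝒞.fillComm u).Nf)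
    (hDn : (𝒟.fillComm v).Nf) (hu : 𝒞.Rightmost u) (hv : 𝒟.Rightmost v)
    (hf : FreeStrongIn S Γ (.par A B (𝒞.fillComm u) (𝒟.fillComm v)))
    (hk : (𝒞.fillComm u).count 0 + (𝒟.fillComm v).count 0 ≤ k)
    (hb : 𝒞.boundVars u ≠ [] →
      (Form.imp (conjTypes (𝒟.boundVars v)) (conjTypes (𝒞.boundVars u))).StrongIn S) :
    ∃ s, Steps (.imp (conjTypes (𝒟.boundVars v)) (conjTypes (𝒞.boundVars u)) :: Γ)
      (.par B A
        ((𝒟.rename (liftRen Nat.succ)).fill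
          (migrate 𝒞.depth 𝒟.depth (𝒞.boundVars u) (𝒟.boundVars v) u))
        ((𝒞.fillComm u).rename (liftRen Nat.succ))) s ∧
      s.ParallelForm ∧ s.KindsIn (Form.LowIn S) ∧
      (s.occurs 0 = true → 𝒞.boundVars u ≠ []) := by
  obtain ⟨w, hw, hwn, hwc⟩ := exists_nf_fill_migrate hC hD hCn hDn hu hv
  set l := (𝒟.rename (liftRen Nat.succ)).fill
    (migrate 𝒞.depth 𝒟.depth (𝒞.boundVars u) (𝒟.boundVars v) u) with hl
  have hsteps : Steps (.imp (conjTypes (𝒟.boundVars v)) (conjTypes (𝒞.boundVars u)) :: Γ)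
      (.par B A l ((𝒞.fillComm u).rename (liftRen Nat.succ)))
      (.par B A w ((𝒞.fillComm u).rename (liftRen Nat.succ))) :=
    .par (hw.steps _) .refl
  have h0 : (Tm.par B A l ((𝒞.fillComm u).rename (liftRen Nat.succ))).occurs 0 = true →
      𝒞.boundVars u ≠ [] := by
    intro h
    rw [Tm.occurs_par, Bool.or_eq_true, zero_add, occurs_liftRen_succ_one] at h
    exact boundVars_ne_nil_of_occurs hu.2 (h.resolve_right (by simp))
  have hcount := Tm.count_rename (t := 𝒞.fillComm u) (ρ := liftRen Nat.succ) (n := 0)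
    fun _ => liftRen_succ_zero
  rw [show liftRen Nat.succ 0 = 0 from rfl] at hcount
  obtain ⟨s, h₁, h₂, h₃⟩ := ih (Δ := .imp (conjTypes (𝒟.boundVars v))
      (conjTypes (𝒞.boundVars u)) :: Γ) (u' := w)
    (v' := (𝒞.fillComm u).rename (liftRen Nat.succ)) (by omega)
    (hsteps.hasType (.par (hasType_fill_migrate hC hD hu.2) (hasType_liftRen_succ.2 hC)))
    hwn (Tm.nf_rename.2 hCn)
    -- The scope now begins with `b`, whose type has to be controlled only if `b` occurs, that is,
    -- only if some bound variable of `u` migrates.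
    (hf.cons (fun n hn => by
        have hn := hsteps.occurs hn
        simp only [Tm.occurs_par, occurs_liftRen_succ, Bool.or_eq_true] at hn ⊢
        exact hn.elim (occurs_fill_migrate hu.2) .inl)
      fun hn => hb (h0 (hsteps.occurs hn)))
  exact ⟨s, hsteps.trans h₁, h₂, h₃, fun h => h0 (hsteps.occurs (h₁.occurs h))⟩

/-- Induction on the total number of occurrences of `a`. If `a` is missing on one side, that side is
kept and the other discarded. Otherwise a cross reduction yields two halves with fewer occurrences
of `a`, joined by a variable `b` whose kind is low because the λ-bound variables have types in `S`.
-/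
theorem exists_lowIn_of_nf (hS : Form.SubClosed S)
    (hC : ∀ P, Form.ProperSubformula P C → S P) (k : ℕ) :
    ∀ {Γ : List Form} {A B : Form} {u v : Tm}, A.FactorIn S → B.FactorIn S →
      ¬ (A.LowIn S ∧ B.LowIn S) → u.count 0 + v.count 0 < k →
      HasType Γ (.par A B u v) C → u.Nf → v.Nf → FreeStrongIn S Γ (.par A B u v) →
      ∃ s, Steps Γ (.par A B u v) s ∧ s.ParallelForm ∧ s.KindsIn (Form.LowIn S) := by
  induction k with
  | zero => intro _ _ _ _ _ _ _ _ h; omega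
  | succ k ih =>
  intro Γ A B u v hA hB hAB hk ht hun hvn hf
  cases hu0 : u.occurs 0 with
  | false =>
    obtain ⟨s, rfl⟩ := Tm.exists_eq_shift hu0
    have hs : s.ParFree := Tm.parFree_rename.1 hun.parFree
    exact ⟨s, .single (.base (.cross (.left Γ A B s v))), .simple hs, hs.kindsIn⟩
  | true =>
  cases hv0 : v.occurs 0 with
  | false =>
    obtain ⟨s, rfl⟩ := Tm.exists_eq_shift hv0
    have hs : s.ParFree := Tm.parFree_rename.1 hvn.parFree
    exact ⟨s, .single (.base (.cross (.right Γ A B u s))), .simple hs, hs.kindsIn⟩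
  | true =>
  have hpos := posComm_of_not_lowIn ht hC hf hAB
  have hSAB : ¬ (S A ∧ S B) := fun h => hAB ⟨hS.lowIn h.1, hS.lowIn h.2⟩
  have hCf := Form.factorIn_of_properSubformula hC
  cases ht with
  | par htu htv =>
  have hfu : FreeStrongIn S (.imp A B :: Γ) u :=
    hf.cons (fun n h => by simp [Tm.occurs, h]) fun _ => Form.strongIn_imp hA hB
  have hfv : FreeStrongIn S (.imp B A :: Γ) v :=
    hf.cons (fun n h => by simp [Tm.occurs, h]) fun _ => Form.strongIn_imp hB hA
  have hbu := hun.bindersIn hS htu hfu hCf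
  have hbv := hvn.bindersIn hS htv hfv hCf
  -- As `A` and `B` are not both in `S`, the subformula property forces every occurrence of `a` to
  -- be applied, which gives the shape required by the cross reduction.
  obtain ⟨𝒞, u, rfl, hru⟩ := Tm.exists_fillComm hun.parFree
    (hun.applied hS htu hfu hCf (n := 0) rfl hSAB) hu0
  obtain ⟨𝒟, v, rfl, hrv⟩ := Tm.exists_fillComm hvn.parFree
    (hvn.applied hS htv hfv hCf (n := 0) rfl fun h => hSAB h.symm) hv0
  have hstep : Step Γ _ _ := .base (.cross (.cross Γ A B 𝒞 𝒟 u v _ _ hun.parFree hun.intNormal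
    hvn.parFree hvn.intNormal hru hrv rfl rfl hpos))
  have hlow𝒞 : 𝒞.boundVars u ≠ [] → (conjTypes (𝒞.boundVars u)).LowIn S := fun h =>
    lowIn_conjTypes_boundVars hS h (Ctx.forall_binders hbu)
  have hlow𝒟 : 𝒟.boundVars v ≠ [] → (conjTypes (𝒟.boundVars v)).LowIn S := fun h =>
    lowIn_conjTypes_boundVars hS h (Ctx.forall_binders hbv)
  -- If no bound variable of `u` migrates, `b` does not occur in the first half, which can therefore
  -- replace the whole composition; its kind, involving `⊤`, disappears. The exchange of sides has
  -- replaced the kind `A, B` of `a` by `B, A`.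
  by_cases hy : 𝒞.boundVars u = []
  · obtain ⟨s, h₁, h₂, h₃, h₄⟩ := exists_lowIn_half (k := k)
      (fun h => ih hB hA (fun h => hAB h.symm) h)
      htu htv hun hvn hru hrv hf (by omega) (fun h => absurd hy h)
    obtain ⟨s, rfl⟩ := Tm.exists_eq_shift (Bool.eq_false_iff.2 fun h => h₄ h hy)
    exact ⟨s, .head hstep ((h₁.par .refl).tail (.base (.cross (.left _ _ _ _ _)))),
      Tm.parallelForm_rename.1 h₂, Tm.kindsIn_rename.1 h₃⟩
  by_cases hz : 𝒟.boundVars v = []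
  · obtain ⟨s, h₁, h₂, h₃, h₄⟩ := exists_lowIn_half (k := k) (fun h => ih hA hB hAB h)
      htv htu hvn hun hrv hru (hf.mono fun n h => by
        rw [Tm.occurs_par, Bool.or_comm] at h; exact h) (by omega) (fun h => absurd hz h)
    obtain ⟨s, rfl⟩ := Tm.exists_eq_shift (Bool.eq_false_iff.2 fun h => h₄ h hz)
    exact ⟨s, .head hstep ((Steps.par .refl h₁).tail (.base (.cross (.right _ _ _ _ _)))),
      Tm.parallelForm_rename.1 h₂, Tm.kindsIn_rename.1 h₃⟩
  have hY := hlow𝒞 hy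
  have hZ := hlow𝒟 hz
  obtain ⟨s, h₁, h₂, h₃, -⟩ := exists_lowIn_half (k := k)
    (fun h => ih hB hA (fun h => hAB h.symm) h) htu htv hun hvn hru hrv hf (by omega)
    (fun _ => Form.strongIn_imp (hS.factorIn hZ) (hS.factorIn hY))
  obtain ⟨r, h₄, h₅, h₆, -⟩ := exists_lowIn_half (k := k) (fun h => ih hA hB hAB h)
    htv htu hvn hun hrv hru (hf.mono fun n h => by
      rw [Tm.occurs_par, Bool.or_comm] at h; exact h) (by omega)
    (fun _ => Form.strongIn_imp (hS.factorIn hY) (hS.factorIn hZ))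
  exact ⟨_, .head hstep (h₁.par h₄), .par h₂ h₅, ⟨hZ, hY⟩, h₃, h₆⟩

/-! ### Lowering the communication kinds of parallel forms -/

/-- Since the outer kind is not low, its complexity stays positive, and the operator may be permuted
inwards until it joins simply typed terms; there the components are normalized and
`exists_lowIn_of_nf` takes over. The operators it passes have low kinds, so their variables, now
free in the inner compositions, respect the condition on free variables. -/
theorem exists_lowIn_of_par (hS : Form.SubClosed S)
    (hC : ∀ P, Form.ProperSubformula P C → S P) {A B : Form} (hA : A.FactorIn S)
    (hB : B.FactorIn S) (hAB : ¬ (A.LowIn S ∧ B.LowIn S)) (k : ℕ) :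
    ∀ {Γ : List Form} {u v : Tm}, u.npar + v.npar ≤ k →
      HasType Γ (.par A B u v) C → FreeStrongIn S Γ (.par A B u v) →
      u.ParallelForm → v.ParallelForm →
      u.KindsIn (Form.LowIn S) → v.KindsIn (Form.LowIn S) →
      ∃ s, Steps Γ (.par A B u v) s ∧ s.ParallelForm ∧ s.KindsIn (Form.LowIn S) := by
  have strong : ∀ {D E : Form}, D.LowIn S → E.LowIn S → (Form.imp D E).StrongIn S :=
    fun hD hE => Form.strongIn_imp (hS.factorIn hD) (hS.factorIn hE)
  induction k using Nat.strong_induction_on with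
  | _ k ih =>
  intro Γ u v hk ht hf hu hv hku hkv
  have hpos := posComm_of_not_lowIn ht hC hf hAB
  cases hu with
  | @par D E u₁ u₂ hu₁ hu₂ =>
    have hstep : Step Γ _ _ := .base (.perm (.parL Γ D E A B u₁ u₂ v hpos))
    have hocc := fun n => hstep.occurs (n := n)
    simp only [Tm.occurs_par (A := D), Bool.or_eq_true] at hocc
    simp only [Tm.npar] at hk
    have hv' := hv.rename (liftRen Nat.succ)
    have hkv' := Tm.kindsIn_rename (ρ := liftRen Nat.succ) |>.2 hkv
    cases hstep.hasType ht with
    | par ht₁ ht₂ =>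
    obtain ⟨s, h₁, h₂, h₃⟩ := ih (u₁.npar + v.npar) (by omega)
      (by rw [Tm.npar_rename, Tm.npar_rename]) ht₁
      (hf.cons (fun n h => hocc n (.inl h)) fun _ => strong hku.1.1 hku.1.2)
      (hu₁.rename _) hv' (Tm.kindsIn_rename.2 hku.2.1) hkv'
    obtain ⟨r, h₄, h₅, h₆⟩ := ih (u₂.npar + v.npar) (by omega)
      (by rw [Tm.npar_rename, Tm.npar_rename]) ht₂
      (hf.cons (fun n h => hocc n (.inr h)) fun _ => strong hku.1.2 hku.1.1)
      (hu₂.rename _) hv' (Tm.kindsIn_rename.2 hku.2.2) hkv'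
    exact ⟨_, .head hstep (h₁.par h₄), .par h₂ h₅, hku.1, h₃, h₆⟩
  | simple hu =>
  cases hv with
  | @par D E v₁ v₂ hv₁ hv₂ =>
    have hstep : Step Γ _ _ := .base (.perm (.parR Γ D E A B v₁ v₂ u hpos))
    have hocc := fun n => hstep.occurs (n := n)
    simp only [Tm.occurs_par (A := D), Bool.or_eq_true] at hocc
    simp only [Tm.npar] at hk
    have hu' := (Tm.ParallelForm.simple hu).rename (liftRen Nat.succ)
    have hku' := Tm.kindsIn_rename (ρ := liftRen Nat.succ) |>.2 hku
    cases hstep.hasType ht with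
    | par ht₁ ht₂ =>
    obtain ⟨s, h₁, h₂, h₃⟩ := ih (u.npar + v₁.npar) (by omega)
      (by rw [Tm.npar_rename, Tm.npar_rename]) ht₁
      (hf.cons (fun n h => hocc n (.inl h)) fun _ => strong hkv.1.1 hkv.1.2)
      hu' (hv₁.rename _) hku' (Tm.kindsIn_rename.2 hkv.2.1)
    obtain ⟨r, h₄, h₅, h₆⟩ := ih (u.npar + v₂.npar) (by omega)
      (by rw [Tm.npar_rename, Tm.npar_rename]) ht₂
      (hf.cons (fun n h => hocc n (.inr h)) fun _ => strong hkv.1.2 hkv.1.1)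
      hu' (hv₂.rename _) hku' (Tm.kindsIn_rename.2 hkv.2.2)
    exact ⟨_, .head hstep (h₁.par h₄), .par h₂ h₅, hkv.1, h₃, h₆⟩
  | simple hv =>
    cases ht with
    | par htu htv =>
    obtain ⟨u', hu', hun⟩ := htu.wn hu
    obtain ⟨v', hv', hvn⟩ := htv.wn hv
    have hs : Steps Γ (.par A B u v) (.par A B u' v') := (hu'.steps _).par (hv'.steps _)
    obtain ⟨s, h₁, h₂⟩ := exists_lowIn_of_nf hS hC _ hA hB hAB (Nat.lt_succ_self _)
      (hs.hasType (.par htu htv)) hun hvn (hf.mono fun _ => hs.occurs)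
    exact ⟨s, hs.trans h₁, h₂⟩

/-- One level of the descent from `FactorIn` to `LowIn`, carried out from the innermost operators
outwards, so that each operator is treated when all those inside it already have low kinds. -/
theorem exists_lowIn (hS : Form.SubClosed S) (hC : ∀ P, Form.ProperSubformula P C → S P) {t : Tm}
    (h : t.ParallelForm) : ∀ {Γ : List Form}, HasType Γ t C → FreeStrongIn S Γ t →
      t.KindsIn (Form.FactorIn S) →
      ∃ s, Steps Γ t s ∧ s.ParallelForm ∧ s.KindsIn (Form.LowIn S) := by
  induction h with
  | @simple t h => exact fun _ _ _ => ⟨t, .refl, .simple h, h.kindsIn⟩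
  | @par A B u v _ _ ihu ihv =>
    intro Γ ht hf hk
    obtain ⟨hA, hB⟩ := hk.1
    cases ht with
    | par htu htv =>
    obtain ⟨u', hu₁, hu₂, hu₃⟩ := ihu htu
      (hf.cons (fun n h => by simp [Tm.occurs, h]) fun _ => Form.strongIn_imp hA hB) hk.2.1
    obtain ⟨v', hv₁, hv₂, hv₃⟩ := ihv htv
      (hf.cons (fun n h => by simp [Tm.occurs, h]) fun _ => Form.strongIn_imp hB hA) hk.2.2
    have hs := hu₁.par hv₁
    by_cases hAB : A.LowIn S ∧ B.LowIn S
    · exact ⟨_, hs, .par hu₂ hv₂, hAB, hu₃, hv₃⟩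
    · obtain ⟨s, h₁, h₂⟩ := exists_lowIn_of_par hS hC hA hB hAB _ le_rfl
        (hs.hasType (.par htu htv)) (hf.mono fun _ => hs.occurs) hu₂ hv₂ hu₃ hv₃
      exact ⟨s, hs.trans h₁, h₂⟩

/-- The set `S` is enlarged by the formulas with fewer than `c + 1` symbols. Once all prime factors
lie in this larger set, their proper subformulas lie in `S` or have fewer than `c` symbols, which is
the hypothesis for `c`. -/
theorem exists_lowIn_of_kindsIn_symbols_le (hS : Form.SubClosed S)
    (hC : ∀ P, Form.ProperSubformula P C → S P) {Γ : List Form} (c : ℕ) : ∀ {t : Tm},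
      t.ParallelForm → HasType Γ t C → FreeStrongIn S Γ t →
      t.KindsIn (Form.FactorIn fun P => S P ∨ P.symbols < c) →
      ∃ s, Steps Γ t s ∧ s.ParallelForm ∧ s.KindsIn (Form.LowIn S) := by
  induction c with
  | zero => intro t h ht hf hk; exact exists_lowIn hS hC h ht hf (by simpa using hk)
  | succ c ih =>
    intro t h ht hf hk
    have hS' : Form.SubClosed fun P => S P ∨ P.symbols < c + 1 := by
      rintro P Q (h | h) hP
      · exact .inl (hS h hP)
      · rcases Form.symbols_le hP with rfl | h'
        · exact .inr h
        · exact .inr (h'.trans h)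
    obtain ⟨s, h₁, h₂, h₃⟩ := exists_lowIn hS' (fun P hP => .inl (hC P hP)) h ht
      (fun n F hn e P hP => .inl (hf n F hn e P hP)) hk
    obtain ⟨r, h₄, h₅⟩ := ih h₂ (h₁.hasType ht) (hf.mono fun _ => h₁.occurs)
      (h₃.mono fun A hA Q hQ P hP => (hA Q hQ).imp (hS · hP.1) fun h => by
        have := hP.symbols_lt; omega)
    exact ⟨r, h₁.trans h₄, h₅⟩

theorem exists_kindsIn_lowIn (hS : Form.SubClosed S)
    (hC : ∀ P, Form.ProperSubformula P C → S P) {Γ : List Form} {t : Tm} (h : t.ParallelForm)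
    (ht : HasType Γ t C) (hf : FreeStrongIn S Γ t) :
    ∃ s, Steps Γ t s ∧ s.ParallelForm ∧ s.KindsIn (Form.LowIn S) := by
  obtain ⟨c, hc⟩ := t.exists_kindsIn_symbols_le
  refine exists_lowIn_of_kindsIn_symbols_le hS hC c h ht hf
    (hc.mono fun A hA Q hQ P hP => .inr ?_)
  have := (hP.trans_mem (Form.mem_subformulas_of_mem_primeFactors hQ)).symbols_lt
  omega

end

/-! ### Normal parallel forms -/

/-- Parallel forms of type `A` in which the simply typed components are normal, communication
variables occur on both sides and communication complexities are zero. -/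
inductive NormalForm (A : Form) : List Form → Tm → Prop where
  | simple {Γ : List Form} {t : Tm} : t.Nf → NormalForm A Γ t
  | par {Γ : List Form} {B C : Form} {u v : Tm} :
      NormalForm A (.imp B C :: Γ) u → NormalForm A (.imp C B :: Γ) v →
      u.occurs 0 = true → v.occurs 0 = true →
      commComplexity Γ (.par B C u v) A B C = 0 → NormalForm A Γ (.par B C u v)

theorem NormalForm.parallelForm {A : Form} {Γ : List Form} {t : Tm} (h : NormalForm A Γ t) :
    t.ParallelForm := by
  induction h with
  | simple h => exact .simple h.parFree
  | par _ _ _ _ _ ihu ihv => exact .par ihu ihv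

/-- Each rule for a composition at the root is blocked: permutations and proper cross reductions
need positive complexity, discarding a side needs a communication variable that is absent from one
component. -/
theorem NormalForm.isNormal {A : Form} {Γ : List Form} {t : Tm} (h : NormalForm A Γ t) :
    HasType Γ t A → IsNormal Γ t := by
  induction h with
  | simple h => exact fun _ => (intNormal_iff_isNormal h.parFree _).1 h.intNormal
  | @par Γ B C u v _ _ hu hv hc ihu ihv =>
    intro ht t' hs
    have hpos : ¬ PosComm Γ B C u v := by
      rintro ⟨A', ht', h⟩
      rw [ht'.unique ht, hc] at h
      exact lt_irrefl _ h
    cases ht with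
    | par htu htv =>
    cases hs with
    | base h =>
      cases h with
      | int h => cases h
      | perm h => cases h <;> exact hpos ‹_›
      | cross h =>
        cases h with
        | left => simp [Tm.occurs_shift_zero] at hu
        | right => simp [Tm.occurs_shift_zero] at hv
        | cross => exact hpos ‹_›
    | parL h => exact ihu htu _ h
    | parR h => exact ihv htv _ h

theorem isFreeVarType_rename {Γ Δ : List Form} {t : Tm} {ρ : ℕ → ℕ}
    (h : ∀ n, t.occurs n = true → Δ[ρ n]? = Γ[n]?) (D : Form) :
    IsFreeVarType Δ (t.rename ρ) D ↔ IsFreeVarType Γ t D := by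
  constructor
  · rintro ⟨n, hn, e⟩
    obtain ⟨m, hm, rfl⟩ := Tm.occurs_rename t |>.1 hn
    exact ⟨m, hm, (h m hm).symm.trans e⟩
  · rintro ⟨n, hn, e⟩
    exact ⟨ρ n, Tm.occurs_rename t |>.2 ⟨n, hn, rfl⟩, (h n hn).trans e⟩

/-- The complexity depends only on the types of the free variables that occur. Thus a component that
is kept when the other is discarded remains a normal form after the communication variable has been
removed from the scope. -/
theorem NormalForm.of_rename {A : Form} {t : Tm} : ∀ {Γ Δ : List Form} {ρ : ℕ → ℕ},
    (∀ n, t.occurs n = true → Δ[ρ n]? = Γ[n]?) → NormalForm A Δ (t.rename ρ) →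
      NormalForm A Γ t := by
  have lift : ∀ {u : Tm} {Γ Δ : List Form} {ρ : ℕ → ℕ} {B : Form},
      (∀ n, u.occurs (n + 1) = true → Δ[ρ n]? = Γ[n]?) →
      ∀ n, u.occurs n = true → (B :: Δ)[liftRen ρ n]? = (B :: Γ)[n]? := by
    intro u Γ Δ ρ B h n hn
    cases n with
    | zero => rfl
    | succ n => simpa [liftRen] using h n hn
  have zero : ∀ {u : Tm} {ρ : ℕ → ℕ}, (u.rename (liftRen ρ)).occurs 0 = true →
      u.occurs 0 = true := by
    intro u ρ h
    obtain ⟨_ | m, hm, e⟩ := Tm.occurs_rename u |>.1 h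
    · exact hm
    · cases e
  induction t with
  | par B C u v ihu ihv =>
    intro Γ Δ ρ h H
    have hc := funext fun D => propext (isFreeVarType_rename h D)
    generalize ht : Tm.rename ρ (.par B C u v) = t at H
    cases H with
    | simple H => subst ht; exact H.elim
    | par hu hv h₁ h₂ h₃ =>
      cases ht
      refine .par (ihu (lift fun n hn => h n (by simp [Tm.occurs, hn])) hu)
        (ihv (lift fun n hn => h n (by simp [Tm.occurs, hn])) hv) (zero h₁) (zero h₂) ?_
      rw [← h₃]
      simp only [Tm.rename] at hc
      rw [commComplexity, commComplexity, hc]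
  | _ =>
    intro Γ Δ ρ h H
    cases H with | simple H => exact .simple (Tm.nf_rename.1 H)

theorem NormalForm.of_shift {A B : Form} {Γ : List Form} {t : Tm}
    (h : NormalForm A (B :: Γ) t.shift) : NormalForm A Γ t :=
  h.of_rename fun n _ => by simp

/-! ### Normalization -/

/-- Induction on the finite set `E`. With the kinds low for `E`, the parallel form is normalized
from the inside out; wherever positive complexity remains, that composition as a whole is handed to
the induction hypothesis with a smaller set. -/
theorem exists_normalForm {A : Form} (E : Finset Form) (hE : Form.SubClosed (· ∈ E))
    (hA : ∀ P, Form.ProperSubformula P A → P ∈ E) : ∀ {Γ : List Form} {t : Tm},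
      t.ParallelForm → HasType Γ t A → FreeStrongIn (· ∈ E) Γ t →
      ∃ s, Steps Γ t s ∧ NormalForm A Γ s := by
  induction E using Finset.strongInduction with
  | H E ih =>
  have struct : ∀ {t : Tm}, t.ParallelForm → ∀ {Γ : List Form}, HasType Γ t A →
      FreeStrongIn (· ∈ E) Γ t → t.KindsIn (Form.LowIn (· ∈ E)) →
      ∃ s, Steps Γ t s ∧ NormalForm A Γ s := by
    intro t h
    induction h with
    | simple h =>
      intro Γ ht _ _
      obtain ⟨s, h₁, h₂⟩ := ht.wn h
      exact ⟨s, h₁.steps Γ, .simple h₂⟩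
    | @par B C u v _ _ ihu ihv =>
      intro Γ ht hf hk
      obtain ⟨hB, hC⟩ := hk.1
      have hB' := hE.factorIn hB
      have hC' := hE.factorIn hC
      have ht₀ := ht
      cases ht with
      | par htu htv =>
      obtain ⟨u, hu, hun⟩ := ihu htu
        (hf.cons (fun n h => by simp [Tm.occurs, h]) fun _ => Form.strongIn_imp hB' hC') hk.2.1
      obtain ⟨v, hv, hvn⟩ := ihv htv
        (hf.cons (fun n h => by simp [Tm.occurs, h]) fun _ => Form.strongIn_imp hC' hB') hk.2.2
      have hs := hu.par hv
      cases hu0 : u.occurs 0 with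
      | false =>
        obtain ⟨s, rfl⟩ := Tm.exists_eq_shift hu0
        exact ⟨s, hs.tail (.base (.cross (.left _ _ _ _ _))), hun.of_shift⟩
      | true =>
      cases hv0 : v.occurs 0 with
      | false =>
        obtain ⟨s, rfl⟩ := Tm.exists_eq_shift hv0
        exact ⟨s, hs.tail (.base (.cross (.right _ _ _ _ _))), hvn.of_shift⟩
      | true =>
      -- Kinds in `E` do not guarantee complexity zero, because the complexity counts only what `A`
      -- and the variables free in this very composition justify.
      rcases Nat.eq_zero_or_pos (commComplexity Γ (.par B C u v) A B C) with hc | hc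
      · exact ⟨_, hs, .par hun hvn hu0 hv0 hc⟩
      obtain ⟨Q, hQ, hQA, hQf⟩ := commComplexity_pos.1 hc
      have hQE : Q ∈ E := hQ.elim (hB Q) (hC Q)
      have hf' : FreeStrongIn (· ∈ E) Γ (.par B C u v) := hf.mono fun _ => hs.occurs
      classical
      -- The smaller set keeps the members of `E` justified by `A` or by the free variables of this
      -- composition. It is still closed under subformulas but lacks `Q`. No condition on the kinds
      -- is needed, since they are lowered anew.
      obtain ⟨s, h₁, h₂⟩ := ih (E.filter fun P => P.ProperSubformula A ∨
          ∃ D, IsFreeVarType Γ (.par B C u v) D ∧ P.StrongSubformula D)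
        (by
          refine Finset.filter_ssubset.2 ⟨Q, hQE, ?_⟩
          rintro (h | ⟨D, h, h'⟩)
          · exact hQA h
          · exact hQf D h h')
        (by
          intro P R hR hP
          rw [Finset.mem_filter] at hR ⊢
          exact ⟨hE hR.1 hP, hR.2.imp (Form.properSubformula_of_mem hP)
            fun ⟨D, h, h'⟩ => ⟨D, h, Form.strongSubformula_of_mem hP h'⟩⟩)
        (fun P hP => Finset.mem_filter.2 ⟨hA P hP, .inl hP⟩)
        (.par hun.parallelForm hvn.parallelForm) (hs.hasType ht₀)
        (fun n F hn e P hP => Finset.mem_filter.2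
          ⟨hf' n F hn e P hP, .inr ⟨F, ⟨n, hn, e⟩, hP⟩⟩)
      exact ⟨s, hs.trans h₁, h₂⟩
  intro Γ t h ht hf
  obtain ⟨s, h₁, h₂, h₃⟩ := exists_kindsIn_lowIn hE hA h ht hf
  obtain ⟨r, h₄, h₅⟩ := struct h₂ (h₁.hasType ht) (hf.mono fun _ => h₁.occurs) h₃
  exact ⟨r, h₁.trans h₄, h₅⟩

theorem HasType.exists_normalForm {Γ : List Form} {t : Tm} {A : Form} (ht : HasType Γ t A) :
    ∃ s, Steps Γ t s ∧ NormalForm A Γ s := by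
  obtain ⟨s, h₁, h₂⟩ := exists_parallelForm t Γ
  obtain ⟨r, h₃, h₄⟩ := LambdaG.exists_normalForm (A := A)
    -- The initial set consists of all subformulas of `A` and of the types in `Γ`.
    ((A :: Γ).toFinset.biUnion Form.subformulas)
    (by
      intro P Q hQ hP
      simp only [Finset.mem_biUnion, List.mem_toFinset] at hQ ⊢
      obtain ⟨F, hF, h⟩ := hQ
      exact ⟨F, hF, Form.subformulas_trans hP h⟩)
    (fun P hP => Finset.mem_biUnion.2 ⟨A, by simp, hP.1⟩) h₂ (h₁.hasType ht)
    (fun n F _ e P hP => Finset.mem_biUnion.2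
      ⟨F, by simp [List.mem_of_getElem? e], hP.properSubformula.1⟩)
  exact ⟨r, h₁.trans h₃, h₄⟩

end LambdaG

theorem mainTheorem1 (Γ : List LambdaG.Form) (t : LambdaG.Tm) (A : LambdaG.Form)
    (ht : LambdaG.HasType Γ t A) :
    ∃ t' : LambdaG.Tm,
      Relation.ReflTransGen (LambdaG.Step Γ) t t' ∧
      LambdaG.HasType Γ t' A ∧
      (∀ n : ℕ, t'.occurs n = true → t.occurs n = true) ∧
      t'.ParallelForm ∧
      LambdaG.IsNormal Γ t' := by
  obtain ⟨s, h, hs⟩ := ht.exists_normalForm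
  have hsA := LambdaG.Steps.hasType h ht
  exact ⟨s, h, hsA, fun _ => LambdaG.Steps.occurs h, hs.parallelForm, hs.isNormal hsA⟩
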